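/- Let $N_4$ be the closed non-orientable surface of genus $4$ (the connected sum of four projective planes). A triangulation of $N_4$ is a two-dimensional simplicial complex $\Delta$ whose underlying space $|\Delta|$ is homeomorphic to $N_4$; triangulations are counted up to combinatorial isomorphism. A polyhedral realization of $\Delta$ is given by an assignment $\psi\colon V(\Delta)\to\mathbb R^3$ of coordinates to the vertices whose induced simplexwise linear map $\phi_\psi\colon|\Delta|\to\mathbb R^3$ is locally injective (an immersion). A geometric symmetry of it is an isometry of $\mathbb R^3$ that maps $\phi_\psi(|\Delta|)$ onto itself and is induced by an automorphism of $\Delta$. At least $112$ pairwise non-isomorphic triangulations of $N_4$ with $10$ vertices possess a polyhedral realization in $\mathbb R^3$, with integer vertex coordinates, that has a $2$-fold rotation (a rotation by the angle $\pi$ about a line) as a geometric symmetry. -/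

import Mathlib

noncomputable section

/-- The generating identifications on the closed unit disc, regarded as a polygon with `2 * h`
sides on its boundary circle, for the boundary word `a₁ a₁ a₂ a₂ ⋯ a_h a_h`: for each `k < h`, the
sides number `2 * k` and `2 * k + 1` (both run counterclockwise) are glued. -/
def crosscapGluing (h : ℕ) (z w : Metric.closedBall (0 : ℂ) 1) : Prop :=
  ∃ k : ℕ, k < h ∧ ∃ t : ℝ, 0 ≤ t ∧ t ≤ 1 ∧
    (z : ℂ) = Complex.exp (((Real.pi * (2 * k + t) / h : ℝ) : ℂ) * Complex.I) ∧
    (w : ℂ) = Complex.exp (((Real.pi * (2 * k + 1 + t) / h : ℝ) : ℂ) * Complex.I)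

/-- The closed non-orientable surface `N_h` of genus `h ≥ 1`, i.e. the connected sum of `h`
projective planes: the quotient of the disc by the equivalence relation generated by
`crosscapGluing h`, with the quotient topology. -/
abbrev NonorientableSurface (h : ℕ) : Type := Quot (crosscapGluing h)

/-- Euclidean 3-space. -/
abbrev Space3 : Type := EuclideanSpace ℝ (Fin 3)

section Complexes

variable {V : Type} [Fintype V]

open Classical in
/-- The underlying space `|K|` of a finite abstract simplicial complex: the points are the
barycentric coordinate vectors whose support is a face. -/
def geomRealization (K : AbstractSimplicialComplex V) : Set (V → ℝ) :=
  {x | x ∈ stdSimplex ℝ V ∧ Finset.univ.filter (fun v => x v ≠ 0) ∈ K}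

/-- `K` is a triangulation of the space `S`: a two-dimensional simplicial complex whose underlying
space is homeomorphic to `S`. All elements of `V` are vertices of `K`. -/
def IsTriangulationOf (K : AbstractSimplicialComplex V) (S : Type) [TopologicalSpace S] : Prop :=
  (∀ s ∈ K, s.card ≤ 3) ∧ (∃ s ∈ K, s.card = 3) ∧ Nonempty (geomRealization K ≃ₜ S)

/-- The bijection `σ` of the vertices is an isomorphism from `K` to `L`. -/
def IsComplexIso (K L : AbstractSimplicialComplex V) (σ : Equiv.Perm V) : Prop :=
  ∀ s : Finset V, s ∈ K ↔ s.map σ.toEmbedding ∈ L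

/-- `K` and `L` are combinatorially isomorphic. -/
def Isomorphic (K L : AbstractSimplicialComplex V) : Prop :=
  ∃ σ : Equiv.Perm V, IsComplexIso K L σ

/-- The simplexwise linear map induced by an assignment `ψ` of coordinates to the vertices,
in barycentric coordinates. -/
def simplexwiseLinear (ψ : V → Space3) (x : V → ℝ) : Space3 :=
  ∑ v, x v • ψ v

/-- `ψ` induces a polyhedral realization of a triangulated non-orientable surface, i.e. a
simplexwise linear immersion: the induced map `|K| → ℝ³` is locally injective. -/
def IsPolyhedralImmersion (K : AbstractSimplicialComplex V) (ψ : V → Space3) : Prop :=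
  ∀ x : geomRealization K, ∃ U ∈ nhds x,
    Set.InjOn (fun y : geomRealization K => simplexwiseLinear ψ y) U

/-- The isometry `R` of space is a geometric symmetry of the realization of `K` induced by `ψ`:
it preserves the image of `|K|` and is induced by an automorphism `σ` of `K`, whose simplicial
self-map of `|K|` is `x ↦ x ∘ σ⁻¹`. -/
def IsGeometricSymmetry (K : AbstractSimplicialComplex V) (ψ : V → Space3)
    (R : Space3 ≃ᵃⁱ[ℝ] Space3) : Prop :=
  R '' (simplexwiseLinear ψ '' geomRealization K) = simplexwiseLinear ψ '' geomRealization K ∧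
  ∃ σ : Equiv.Perm V, IsComplexIso K K σ ∧
    ∀ x ∈ geomRealization K, R (simplexwiseLinear ψ x) = simplexwiseLinear ψ (x ∘ σ.symm)

end Complexes

/-- `R` is a 2-fold rotation: the rotation by the angle `π` about the line through `p` with unit
direction vector `u`. It keeps the component of `x - p` along `u` and negates the component
orthogonal to `u`. -/
def IsTwofoldRotation (R : Space3 ≃ᵃⁱ[ℝ] Space3) : Prop :=
  ∃ p u : Space3, ‖u‖ = 1 ∧
    ∀ x : Space3, R x = p + inner ℝ u (x - p) • u - ((x - p) - inner ℝ u (x - p) • u)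

end

/-!
Gluing the sides of a triangulated polygon gives a triangulation of `N₄` with 22 vertices. A
bistellar move does not change the underlying space: it shifts weight from the face to the opposite
face, which is a homeomorphism with the reverse move as inverse. Hence every complex that is
connected to the glued polygon by bistellar moves is a triangulation of `N₄`. The ten-vertex
complexes found in this way are told apart by an isomorphism invariant computed from iterated
colour refinement.

Since the open stars of the vertices cover the surface, a simplexwise linear map is locally
injective as soon as it is injective on each open star. This holds if the cones spanned by the link
of a vertex, seen from that vertex, meet only in common faces, and for integer coordinates the signs
of some `3 × 3` determinants decide this. Where the map commutes with a symmetry, one vertex from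
each orbit suffices.
-/

section FacetSpace

theorem linearMap_apply_of_injOn {V W : Type*} [Finite V] [Finite W] {e : V → W} {s : Set V}
    (he : Set.InjOn e s) {x : V → ℝ} (hx : Function.support x ⊆ s) {v : V} (hv : v ∈ s) :
    FunOnFinite.linearMap ℝ ℝ e x (e v) = x v := by
  classical
  have := Fintype.ofFinite V
  rw [FunOnFinite.linearMap_apply_apply]
  refine Finset.sum_eq_single v (fun v' hv' hne => ?_) fun hv' => absurd ?_ hv'
  · by_contra hxv'
    exact hne (he (hx hxv') hv (Finset.mem_filter.1 hv').2)
  · exact Finset.mem_filter.2 ⟨Finset.mem_univ _, rfl⟩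

variable {V W : Type*} [Fintype V] [Fintype W] [DecidableEq W]

/-- The underlying space of the simplicial complex with facets `T`, in barycentric coordinates. -/
def facetSpace (T : Finset (Finset V)) : Set (V → ℝ) :=
  {x | x ∈ stdSimplex ℝ V ∧ ∃ t ∈ T, Function.support x ⊆ t}

theorem isCompact_facetSpace (T : Finset (Finset V)) : IsCompact (facetSpace T) := by
  have hunion : facetSpace T = ⋃ t ∈ T, stdSimplex ℝ V ∩ {x | ∀ v ∉ t, x v = 0} := by
    ext x
    simp only [facetSpace, Function.support_subset_iff', Finset.mem_coe, Set.mem_ofPred_eq,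
      Set.mem_iUnion, Set.mem_inter_iff, exists_prop]
    exact ⟨fun ⟨hx, t, ht, h⟩ => ⟨t, ht, hx, h⟩, fun ⟨t, ht, hx, h⟩ => ⟨hx, t, ht, h⟩⟩
  rw [hunion]
  refine T.isCompact_biUnion fun t _ => (isCompact_stdSimplex ℝ V).inter_right ?_
  simp only [Set.ofPred_forall]
  exact isClosed_biInter fun v _ => isClosed_eq (continuous_apply v) continuous_const

theorem linearMap_mem_facetSpace_image (e : V → W) {T : Finset (Finset V)} {x : V → ℝ}
    (hx : x ∈ facetSpace T) :
    FunOnFinite.linearMap ℝ ℝ e x ∈ facetSpace (T.image (Finset.image e)) := by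
  obtain ⟨hx, t, ht, hxt⟩ := hx
  refine ⟨stdSimplex.image_linearMap e ⟨x, hx, rfl⟩, t.image e, Finset.mem_image_of_mem _ ht, ?_⟩
  intro w hw
  rw [Function.mem_support, FunOnFinite.linearMap_apply_apply] at hw
  obtain ⟨v, hv, hxv⟩ := Finset.exists_ne_zero_of_sum_ne_zero hw
  exact Finset.mem_coe.2 (Finset.mem_image.2 ⟨v, hxt hxv, (Finset.mem_filter.1 hv).2⟩)

/-- The simplicial map between the underlying spaces induced by a map `e` of the vertices. -/
noncomputable def facetSpaceMap (e : V → W) (T : Finset (Finset V)) :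
    facetSpace T → facetSpace (T.image (Finset.image e)) :=
  fun x => ⟨FunOnFinite.linearMap ℝ ℝ e x, linearMap_mem_facetSpace_image e x.2⟩

theorem continuous_facetSpaceMap (e : V → W) (T : Finset (Finset V)) :
    Continuous (facetSpaceMap e T) :=
  ((FunOnFinite.continuous_linearMap ℝ ℝ e).comp continuous_subtype_val).subtype_mk _

theorem facetSpaceMap_surjective (e : V → W) (T : Finset (Finset V)) :
    Function.Surjective (facetSpaceMap e T) := by
  classical
  rintro ⟨y, hy, t', ht', hyt'⟩
  obtain ⟨t, ht, rfl⟩ := Finset.mem_image.1 ht'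
  obtain ⟨v₀, -⟩ : t.Nonempty := by
    by_contra hempty
    have hzero : y = 0 := by
      simpa [Finset.not_nonempty_iff_eq_empty.1 hempty] using hyt'
    exact zero_ne_one ((Finset.sum_eq_zero fun w _ => congrFun hzero w).symm.trans hy.2)
  have hsection : ∀ w, ∃ v, w ∈ t.image e → v ∈ t ∧ e v = w := fun w => by
    by_cases hw : w ∈ t.image e
    · exact (Finset.mem_image.1 hw).imp fun v hv _ => hv
    · exact ⟨v₀, fun h => absurd h hw⟩
  choose g hg using hsection
  have hgy : ∀ w, y w ≠ 0 → g w ∈ t ∧ e (g w) = w := fun w hw => hg w (hyt' hw)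
  refine ⟨⟨FunOnFinite.linearMap ℝ ℝ g y, stdSimplex.image_linearMap g ⟨y, hy, rfl⟩, t, ht,
    fun v hv => ?_⟩, Subtype.ext (funext fun w => ?_)⟩
  · rw [Function.mem_support, FunOnFinite.linearMap_apply_apply] at hv
    obtain ⟨w, hw, hyw⟩ := Finset.exists_ne_zero_of_sum_ne_zero hv
    exact (Finset.mem_filter.1 hw).2 ▸ (hgy w hyw).1
  · change FunOnFinite.linearMap ℝ ℝ e (FunOnFinite.linearMap ℝ ℝ g y) w = y w
    rw [← LinearMap.comp_apply, ← FunOnFinite.linearMap_comp, FunOnFinite.linearMap_apply_apply]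
    refine Finset.sum_eq_single w (fun w' hw' hne => ?_) fun hw => ?_
    · by_contra hyw'
      exact hne ((hgy w' hyw').2.symm.trans (Finset.mem_filter.1 hw').2)
    · by_contra hyw
      exact hw (Finset.mem_filter.2 ⟨Finset.mem_univ _, (hgy w hyw).2⟩)

theorem nonempty_facetSpace_homeomorph_image {e : V → W} (he : Function.Injective e)
    (T : Finset (Finset V)) :
    Nonempty (facetSpace T ≃ₜ facetSpace (T.image (Finset.image e))) := by
  have : CompactSpace (facetSpace T) := isCompact_iff_compactSpace.1 (isCompact_facetSpace T)
  have hinj : Function.Injective (facetSpaceMap e T) := fun x y hxy => by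
    have hval (x : facetSpace T) (v : V) : (facetSpaceMap e T x : W → ℝ) (e v) = (x : V → ℝ) v :=
      linearMap_apply_of_injOn he.injOn (Set.subset_univ _) (Set.mem_univ v)
    exact Subtype.ext (funext fun v => by rw [← hval x, ← hval y, hxy])
  let E := Equiv.ofBijective _ ⟨hinj, facetSpaceMap_surjective e T⟩
  exact ⟨Continuous.homeoOfEquivCompactToT2 (f := E) (continuous_facetSpaceMap e T)⟩

theorem eq_of_facetSpaceMap_eq {e : V → W} {T : Finset (Finset V)} {v : V}
    (hstar : Set.InjOn e {w | ∃ t ∈ T, v ∈ t ∧ w ∈ t}) (hv : ∀ w, e w = e v → w = v)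
    {x y : facetSpace T} (hx : (x : V → ℝ) v ≠ 0)
    (hxy : facetSpaceMap e T x = facetSpaceMap e T y) : x = y := by
  have hval (x : facetSpace T) : (facetSpaceMap e T x : W → ℝ) (e v) = (x : V → ℝ) v := by
    refine (FunOnFinite.linearMap_apply_apply ℝ ℝ e x (e v)).trans ?_
    refine Finset.sum_eq_single v (fun w hw hne => absurd (hv w ?_) hne) fun h => absurd ?_ h
    exacts [(Finset.mem_filter.1 hw).2, Finset.mem_filter.2 ⟨Finset.mem_univ v, rfl⟩]
  have hsupport (x : facetSpace T) (hx : (x : V → ℝ) v ≠ 0) :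
      Function.support (x : V → ℝ) ⊆ {w | ∃ t ∈ T, v ∈ t ∧ w ∈ t} := by
    obtain ⟨t, ht, hxt⟩ := x.2.2
    exact fun w hw => ⟨t, ht, hxt hx, hxt hw⟩
  have hy : (y : V → ℝ) v ≠ 0 := by rwa [← hval, ← hxy, hval]
  refine Subtype.ext (funext fun w => ?_)
  by_cases hw : ∃ t ∈ T, v ∈ t ∧ w ∈ t
  · rw [← linearMap_apply_of_injOn hstar (hsupport x hx) hw,
      ← linearMap_apply_of_injOn hstar (hsupport y hy) hw]
    exact congrArg (fun z : facetSpace _ => (z : W → ℝ) (e w)) hxy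
  · rw [Function.notMem_support.1 fun h => hw (hsupport x hx h),
      Function.notMem_support.1 fun h => hw (hsupport y hy h)]

end FacetSpace

section Realization

variable {V : Type}

/-- The simplicial complex with facets `T`, where every vertex lies in a facet. -/
def facetComplex (T : Finset (Finset V)) (hT : ∀ v, ∃ t ∈ T, v ∈ t) :
    AbstractSimplicialComplex V where
  faces := {s | s.Nonempty ∧ ∃ t ∈ T, s ⊆ t}
  isRelLowerSet_faces := fun _ hs =>
    ⟨hs.1, fun _ hu hne => ⟨hne, hs.2.imp fun _ ht => ⟨ht.1, hu.trans ht.2⟩⟩⟩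
  singleton_mem := fun v => ⟨Finset.singleton_nonempty v, (hT v).imp fun _ ht =>
    ⟨ht.1, Finset.singleton_subset_iff.2 ht.2⟩⟩

theorem mem_facetComplex {T : Finset (Finset V)} {hT : ∀ v, ∃ t ∈ T, v ∈ t} {s : Finset V} :
    s ∈ facetComplex T hT ↔ s.Nonempty ∧ ∃ t ∈ T, s ⊆ t := Iff.rfl

theorem geomRealization_facetComplex [Fintype V] (T : Finset (Finset V))
    (hT : ∀ v, ∃ t ∈ T, v ∈ t) :
    geomRealization (facetComplex T hT) = facetSpace T := by
  classical
  ext x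
  refine and_congr_right fun hx => ?_
  have hne : (Finset.univ.filter (x · ≠ 0)).Nonempty := by
    by_contra hne
    rw [Finset.not_nonempty_iff_eq_empty, Finset.filter_eq_empty_iff] at hne
    have hsum : ∑ v, x v = 0 := Finset.sum_eq_zero fun v hv => not_not.1 (hne hv)
    exact zero_ne_one (hsum.symm.trans hx.2)
  simp only [mem_facetComplex, Finset.subset_iff, Finset.mem_filter_univ,
    Function.support_subset_iff, Finset.mem_coe]
  convert and_iff_right hne

end Realization

section BistellarMoves

variable {V : Type*} [DecidableEq V]

/-- One direction of a bistellar move: the facets of `T` containing `A` lie in the join of `A` with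
the boundary of `B`, which is replaced in `T'` by the join of the boundary of `A` with `B`. -/
structure BistellarHalf (A B : Finset V) (T T' : Finset (Finset V)) : Prop where
  nonempty : A.Nonempty
  disjoint : Disjoint A B
  subset_union : ∀ t ∈ T, A ⊆ t → t ⊆ A ∪ B
  not_subset : ∀ t ∈ T, ¬ B ⊆ t
  keep : ∀ t ∈ T, ¬ A ⊆ t → t ∈ T'
  insert : ∀ a ∈ A, (A ∪ B).erase a ∈ T'

/-- The map underlying a bistellar move, in barycentric coordinates: the smallest weight on `A` is
taken off all vertices of `A` and the removed mass is spread evenly over `B`. -/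
noncomputable def bistellarMap (A B : Finset V) (hA : A.Nonempty) (x : V → ℝ) (v : V) : ℝ :=
  x v - (if v ∈ A then A.inf' hA x else 0) +
    (if v ∈ B then A.inf' hA x * (A.card / B.card) else 0)

theorem continuous_bistellarMap (A B : Finset V) (hA : A.Nonempty) :
    Continuous (bistellarMap A B hA) := by
  have : Continuous fun x : V → ℝ => A.inf' hA x :=
    Continuous.finset_inf'_apply hA fun i _ => continuous_apply i
  refine continuous_pi fun v => ?_
  unfold bistellarMap
  split_ifs <;> fun_prop

theorem bistellarMap_eq_self {A B : Finset V} (hA : A.Nonempty) {x : V → ℝ} (hx : ∀ v, 0 ≤ x v)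
    (hzero : ∃ a ∈ A, x a = 0) : bistellarMap A B hA x = x := by
  obtain ⟨a, ha, hxa⟩ := hzero
  have hinf : A.inf' hA x = 0 :=
    le_antisymm (hxa ▸ Finset.inf'_le x ha) ((Finset.le_inf'_iff _ _).2 fun i _ => hx i)
  funext v
  simp [bistellarMap, hinf]

namespace BistellarHalf

variable [Fintype V] {A B : Finset V} {T T' : Finset (Finset V)} {x : V → ℝ}

theorem inf_right_eq_zero (h : BistellarHalf A B T T') (hB : B.Nonempty) (hx : x ∈ facetSpace T) :
    B.inf' hB x = 0 := by
  obtain ⟨⟨hpos, -⟩, t, ht, hxt⟩ := hx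
  obtain ⟨b, hb, hbt⟩ := Finset.not_subset.1 (h.not_subset t ht)
  have hxb : x b = 0 := Function.notMem_support.1 fun hne => hbt (hxt hne)
  exact le_antisymm (hxb ▸ Finset.inf'_le x hb) ((Finset.le_inf'_iff _ _).2 fun i _ => hpos i)

theorem bistellarMap_mem_stdSimplex (hA : A.Nonempty) (hB : B.Nonempty) (hx : x ∈ stdSimplex ℝ V) :
    bistellarMap A B hA x ∈ stdSimplex ℝ V := by
  have hinf : 0 ≤ A.inf' hA x := (Finset.le_inf'_iff _ _).2 fun i _ => hx.1 i
  refine ⟨fun v => add_nonneg (sub_nonneg.2 ?_) (by split_ifs <;> positivity), ?_⟩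
  · split_ifs with hv
    · exact Finset.inf'_le x hv
    · exact hx.1 v
  · have hcard : (B.card : ℝ) ≠ 0 := by exact_mod_cast hB.card_pos.ne'
    simp only [bistellarMap, Finset.sum_add_distrib, Finset.sum_sub_distrib, hx.2,
      Finset.sum_ite_mem, Finset.univ_inter, Finset.sum_const, nsmul_eq_mul]
    field_simp
    ring

theorem mapsTo (h : BistellarHalf A B T T') (hB : B.Nonempty) :
    Set.MapsTo (bistellarMap A B h.nonempty) (facetSpace T) (facetSpace T') := by
  rintro x ⟨hx, t, ht, hxt⟩
  refine ⟨bistellarMap_mem_stdSimplex h.nonempty hB hx, ?_⟩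
  by_cases hAt : A ⊆ t
  · obtain ⟨a, ha, hxa⟩ := A.exists_mem_eq_inf' h.nonempty x
    refine ⟨_, h.insert a ha, fun v hv => ?_⟩
    have haB : a ∉ B := Finset.disjoint_left.1 h.disjoint ha
    rw [Finset.mem_coe, Finset.mem_erase]
    constructor
    · rintro rfl
      exact hv (by simp [bistellarMap, ha, haB, ← hxa])
    · by_contra hvAB
      have hxv : x v = 0 :=
        Function.notMem_support.1 fun hne => hvAB (h.subset_union t ht hAt (hxt hne))
      rw [Finset.notMem_union] at hvAB
      exact hv (by simp [bistellarMap, hvAB.1, hvAB.2, hxv])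
  · obtain ⟨a, ha, hat⟩ := Finset.not_subset.1 hAt
    have hxa : x a = 0 := Function.notMem_support.1 fun hne => hat (hxt hne)
    have hfix := bistellarMap_eq_self (B := B) h.nonempty hx.1 ⟨a, ha, hxa⟩
    exact ⟨t, h.keep t ht hAt, hfix.symm ▸ hxt⟩

theorem leftInvOn (h : BistellarHalf A B T T') (hB : B.Nonempty) :
    Set.LeftInvOn (bistellarMap B A hB) (bistellarMap A B h.nonempty) (facetSpace T) := by
  intro x hx
  have hcA : (A.card : ℝ) ≠ 0 := by exact_mod_cast h.nonempty.card_pos.ne'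
  have hcB : (B.card : ℝ) ≠ 0 := by exact_mod_cast hB.card_pos.ne'
  have hinf : B.inf' hB (bistellarMap A B h.nonempty x) =
      A.inf' h.nonempty x * (A.card / B.card) := by
    have hval : ∀ b ∈ B, bistellarMap A B h.nonempty x b =
        x b + A.inf' h.nonempty x * (A.card / B.card) := fun b hb => by
      simp [bistellarMap, hb, Finset.disjoint_right.1 h.disjoint hb]
    obtain ⟨b, hb, hxb⟩ := B.exists_mem_eq_inf' hB x
    rw [h.inf_right_eq_zero hB hx] at hxb
    refine le_antisymm ((Finset.inf'_le _ hb).trans_eq ?_)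
      ((Finset.le_inf'_iff _ _).2 fun i hi => ?_)
    · rw [hval b hb, ← hxb, zero_add]
    · rw [hval i hi]
      exact le_add_of_nonneg_left (hx.1.1 i)
  funext v
  rw [bistellarMap, hinf, bistellarMap]
  by_cases hvA : v ∈ A
  · simp only [hvA, Finset.disjoint_left.1 h.disjoint hvA, if_true, if_false]
    field_simp
    ring
  · by_cases hvB : v ∈ B <;> simp [hvA, hvB]

theorem exists_homeomorph (h : BistellarHalf A B T T') (h' : BistellarHalf B A T' T) :
    ∃ e : facetSpace T ≃ₜ facetSpace T',
      ∀ x : facetSpace T, (∃ a ∈ A, (x : V → ℝ) a = 0) → (e x : V → ℝ) = x :=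
  ⟨{ toFun := fun x => ⟨_, h.mapsTo h'.nonempty x.2⟩
     invFun := fun y => ⟨_, h'.mapsTo h.nonempty y.2⟩
     left_inv := fun x => Subtype.ext (h.leftInvOn h'.nonempty x.2)
     right_inv := fun y => Subtype.ext (h'.leftInvOn h.nonempty y.2)
     continuous_toFun := ((continuous_bistellarMap A B _).comp continuous_subtype_val).subtype_mk _
     continuous_invFun :=
      ((continuous_bistellarMap B A _).comp continuous_subtype_val).subtype_mk _ },
    fun x hx => bistellarMap_eq_self h.nonempty x.2.1.1 hx⟩

end BistellarHalf

/-- The face whose boundary is the link of the face `A`, whenever that link is the boundary of a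
simplex. -/
def oppositeFace (T : Finset (Finset V)) (A : Finset V) : Finset V :=
  (T.filter (A ⊆ ·)).sup id \ A

/-- The facets after the bistellar move at the face `A` of the complex with facets `T`. -/
def bistellarMove (T : Finset (Finset V)) (A : Finset V) : Finset (Finset V) :=
  A.image (A ∪ oppositeFace T A).erase ∪ T.filter (¬ A ⊆ ·)

/-- The bistellar move at the face `A` can be performed: the link of `A` is the boundary of a
simplex that is not itself a face. -/
def BistellarAdmissible (T : Finset (Finset V)) (A : Finset V) : Prop :=
  A.Nonempty ∧ (oppositeFace T A).Nonempty ∧ (∀ t ∈ T, ¬ oppositeFace T A ⊆ t) ∧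
    ∀ b ∈ oppositeFace T A, (A ∪ oppositeFace T A).erase b ∈ T

instance (T : Finset (Finset V)) (A : Finset V) : Decidable (BistellarAdmissible T A) :=
  inferInstanceAs (Decidable (_ ∧ _))

/-- Performing bistellar moves at the given faces, one after the other, leads from the facets `T`
to the facets `T'`. -/
def MovesTo : List (Finset V) → Finset (Finset V) → Finset (Finset V) → Prop
  | [], T, T' => T = T'
  | A :: L, T, T' => BistellarAdmissible T A ∧ MovesTo L (bistellarMove T A) T'

instance MovesTo.instDecidable :
    (L : List (Finset V)) → (T T' : Finset (Finset V)) → Decidable (MovesTo L T T')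
  | [], _, _ => inferInstanceAs (Decidable (_ = _))
  | A :: L, T, T' =>
    haveI := MovesTo.instDecidable L (bistellarMove T A) T'
    inferInstanceAs (Decidable (_ ∧ _))

theorem BistellarAdmissible.half {T : Finset (Finset V)} {A : Finset V}
    (h : BistellarAdmissible T A) :
    BistellarHalf A (oppositeFace T A) T (bistellarMove T A) where
  nonempty := h.1
  disjoint := Finset.disjoint_sdiff
  subset_union t ht hA := by
    rw [oppositeFace, Finset.union_sdiff_self_eq_union]
    exact Finset.subset_union_right.trans' (Finset.le_sup (f := id) (Finset.mem_filter.2 ⟨ht, hA⟩))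
  not_subset := h.2.2.1
  keep _ ht hA := Finset.mem_union_right _ (Finset.mem_filter.2 ⟨ht, hA⟩)
  insert _ ha := Finset.mem_union_left _ (Finset.mem_image_of_mem _ ha)

theorem BistellarAdmissible.half_symm {T : Finset (Finset V)} {A : Finset V}
    (h : BistellarAdmissible T A) :
    BistellarHalf (oppositeFace T A) A (bistellarMove T A) T := by
  have hmem : ∀ t ∈ bistellarMove T A, (∃ a ∈ A, (A ∪ oppositeFace T A).erase a = t) ∨
      t ∈ T ∧ ¬ A ⊆ t := fun t ht => by
    simpa only [bistellarMove, Finset.mem_union, Finset.mem_image, Finset.mem_filter] using ht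
  refine ⟨h.2.1, Finset.sdiff_disjoint, fun t ht hB => ?_, fun t ht hA => ?_, fun t ht hB => ?_,
    fun b hb => Finset.union_comm A _ ▸ h.2.2.2 b hb⟩
  · obtain ⟨a, -, rfl⟩ | ⟨ht, -⟩ := hmem t ht
    · exact Finset.union_comm A _ ▸ Finset.erase_subset _ _
    · exact absurd hB (h.2.2.1 t ht)
  · obtain ⟨a, ha, rfl⟩ | ⟨-, hA'⟩ := hmem t ht
    · exact Finset.notMem_erase a _ (hA ha)
    · exact hA' hA
  · obtain ⟨a, ha, rfl⟩ | ⟨ht, -⟩ := hmem t ht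
    · refine absurd (Finset.subset_erase.2 ⟨Finset.subset_union_right, fun haB => ?_⟩) hB
      exact (Finset.mem_sdiff.1 haB).2 ha
    · exact ht

theorem MovesTo.exists_homeomorph [Fintype V] :
    ∀ {L : List (Finset V)} {T T' : Finset (Finset V)}, MovesTo L T T' →
      ∃ e : facetSpace T ≃ₜ facetSpace T',
        ∀ x : facetSpace T, (∀ A ∈ L, ∃ a ∈ A, (x : V → ℝ) a = 0) → (e x : V → ℝ) = x
  | [], _, _, rfl => ⟨Homeomorph.refl _, fun _ _ => rfl⟩
  | A :: L, _, _, ⟨hA, hL⟩ => by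
    obtain ⟨e, he⟩ := hA.half.exists_homeomorph hA.half_symm
    obtain ⟨e', he'⟩ := hL.exists_homeomorph
    refine ⟨e.trans e', fun x hx => ?_⟩
    have hex := he x (hx A List.mem_cons_self)
    refine (he' (e x) fun B hB => ?_).trans hex
    rw [hex]
    exact hx B (List.mem_cons_of_mem A hB)

theorem MovesTo.nonempty_homeomorph [Fintype V] {L : List (Finset V)} {T T' : Finset (Finset V)}
    (h : MovesTo L T T') : Nonempty (facetSpace T ≃ₜ facetSpace T') :=
  h.exists_homeomorph.nonempty

end BistellarMoves

section Cone

open unitInterval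

theorem ne_succ_of_eq_iff_dvd_sub {V : Type*} {n : ℕ} (hn : 2 ≤ n) {b : ℕ → V}
    (hb : ∀ i j, b i = b j ↔ (n : ℤ) ∣ i - j) (i : ℕ) : b i ≠ b (i + 1) := fun h => by
  have := Int.le_of_dvd one_pos ((dvd_neg.2 ((hb _ _).1 h)).trans (by simp))
  lia

variable {V : Type*} [DecidableEq V]

/-- The point dividing the edge from the vertex `b i` to the vertex `b (i + 1)` in the ratio
`s : 1 - s`, in barycentric coordinates. -/
def edgePoint (b : ℕ → V) (i : ℕ) (s : ℝ) : V → ℝ :=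
  Pi.single (b i) (1 - s) + Pi.single (b (i + 1)) s

theorem edgePoint_zero (b : ℕ → V) (i : ℕ) : edgePoint b i 0 = Pi.single (b i) 1 := by
  simp [edgePoint]

theorem edgePoint_one (b : ℕ → V) (i : ℕ) : edgePoint b i 1 = Pi.single (b (i + 1)) 1 := by
  simp [edgePoint]

theorem edgePoint_apply_eq_zero {b : ℕ → V} {v : V} (hv : ∀ i, b i ≠ v) (i : ℕ) (s : ℝ) :
    edgePoint b i s v = 0 := by
  simp [edgePoint, (hv _).symm]

theorem edgePoint_mem_stdSimplex [Fintype V] (b : ℕ → V) (i : ℕ) (s : I) :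
    edgePoint b i s ∈ stdSimplex ℝ V :=
  ⟨fun v => by
    have hsingle (w : V) {r : ℝ} (hr : 0 ≤ r) : 0 ≤ (Pi.single w r : V → ℝ) v :=
      (Pi.single_nonneg (α := fun _ : V => ℝ)).2 hr v
    exact add_nonneg (hsingle _ (one_minus_nonneg s)) (hsingle _ (nonneg s)),
    by simp [edgePoint, Finset.sum_add_distrib]⟩

theorem eq_of_single_eq_edgePoint {Z : Type*} {f : ℝ → Z} {b : ℕ → V}
    (hf : ∀ i j : ℕ, b i = b j → f i = f j) {i j : ℕ} {s : ℝ} (hj : b j ≠ b (j + 1))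
    (h : Pi.single (b i) 1 = edgePoint b j s) : f i = f (j + s) := by
  have hleft := congrFun h (b j)
  have hright := congrFun h (b (j + 1))
  simp only [edgePoint, Pi.add_apply, Pi.single_apply, hj, hj.symm, if_true, if_false, add_zero,
    zero_add] at hleft hright
  by_cases hij : b j = b i
  · obtain rfl : s = 0 := by simp only [hij, if_true] at hleft; linarith
    rw [add_zero]
    exact hf i j hij.symm
  · obtain rfl : s = 1 := by simp only [hij, if_false] at hleft; linarith
    rw [← Nat.cast_add_one]
    exact hf i (j + 1) (by_contra fun hne => by simp [Ne.symm hne] at hright)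

theorem eq_of_edgePoint_eq {Z : Type*} {f : ℝ → Z} {b : ℕ → V}
    (hf : ∀ i j : ℕ, b i = b j → f i = f j) {i j : ℕ} {s s' : ℝ}
    (hi : b i ≠ b (i + 1)) (hj : b j ≠ b (j + 1))
    (hsame : b i = b j → b (i + 1) = b (j + 1) → f (i + s) = f (j + s))
    (hreversed : b i = b (j + 1) → b (i + 1) ≠ b j)
    (h : edgePoint b i s = edgePoint b j s') : f (i + s) = f (j + s') := by
  by_cases hs0 : s = 0
  · rw [hs0, edgePoint_zero] at h
    rw [hs0, add_zero, eq_of_single_eq_edgePoint hf hj h]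
  by_cases hs1 : s = 1
  · rw [hs1, edgePoint_one] at h
    rw [hs1, ← Nat.cast_add_one, eq_of_single_eq_edgePoint hf hj h]
  have hleft := congrFun h (b i)
  have hright := congrFun h (b (i + 1))
  simp only [edgePoint, Pi.add_apply, Pi.single_apply, hi, hi.symm, if_true, if_false, add_zero,
    zero_add] at hleft hright
  have hends : b i = b j ∧ b (i + 1) = b (j + 1) := by grind
  obtain rfl : s = s' := by simpa [hends.1, hends.2, hj] using hleft
  exact hsame hends.1 hends.2

/-- The point with parameter `u` on the unit circle, parametrized with period `n`. -/
noncomputable def circlePoint (n : ℕ) (u : ℝ) : ℂ :=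
  Complex.exp ((2 * Real.pi * u / n : ℝ) * Complex.I)

theorem norm_circlePoint (n : ℕ) (u : ℝ) : ‖circlePoint n u‖ = 1 :=
  Complex.norm_exp_ofReal_mul_I _

theorem continuous_circlePoint (n : ℕ) : Continuous (circlePoint n) := by
  unfold circlePoint
  fun_prop

theorem circlePoint_eq_iff {n : ℕ} (hn : n ≠ 0) {u u' : ℝ} :
    circlePoint n u = circlePoint n u' ↔ ∃ k : ℤ, u = u' + k * n := by
  have hn' : (n : ℝ) ≠ 0 := Nat.cast_ne_zero.2 hn
  rw [circlePoint, circlePoint, Complex.exp_eq_exp_iff_exists_int]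
  refine exists_congr fun k => ?_
  rw [show ((2 * Real.pi * u' / n : ℝ) : ℂ) * Complex.I + k * (2 * Real.pi * Complex.I) =
      ((2 * Real.pi * (u' + k * n) / n : ℝ) : ℂ) * Complex.I by
    push_cast
    field_simp, mul_left_inj' Complex.I_ne_zero, Complex.ofReal_inj, div_left_inj' hn',
    mul_right_inj' Real.two_pi_pos.ne']

theorem exists_circlePoint_eq {n : ℕ} (hn : n ≠ 0) (z : ℂ) :
    ∃ (i : Fin n) (s : I), (‖z‖ : ℂ) * circlePoint n ((i : ℕ) + s) = z := by
  have hn' : (0 : ℝ) < n := Nat.cast_pos.2 hn.bot_lt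
  set u : ℝ := Int.fract (z.arg / (2 * Real.pi)) * n with hu
  have hu0 : 0 ≤ u := mul_nonneg (Int.fract_nonneg _) hn'.le
  have hun : u < n := mul_lt_of_lt_one_left hn' (Int.fract_lt_one _)
  refine ⟨⟨⌊u⌋₊, (Nat.floor_lt hu0).2 hun⟩, ⟨u - ⌊u⌋₊, sub_nonneg.2 (Nat.floor_le hu0),
    (sub_lt_iff_lt_add'.2 (Nat.lt_floor_add_one u)).le⟩, ?_⟩
  have harg : circlePoint n u = circlePoint n (z.arg / (2 * Real.pi) * n) :=
    (circlePoint_eq_iff hn).2 ⟨-⌊z.arg / (2 * Real.pi)⌋, by rw [hu, Int.fract]; push_cast; ring⟩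
  have hcancel : 2 * Real.pi * (z.arg / (2 * Real.pi) * n) / n = z.arg := by field_simp
  rw [add_sub_cancel, harg, circlePoint, hcancel]
  exact Complex.norm_mul_exp_arg_mul_I z

theorem edgePoint_eq_iff_circlePoint_eq {n : ℕ} (hn : 3 ≤ n) {b : ℕ → V}
    (hb : ∀ i j, b i = b j ↔ (n : ℤ) ∣ i - j) (i j : ℕ) (s s' : I) :
    edgePoint b i s = edgePoint b j s' ↔ circlePoint n (i + s) = circlePoint n (j + s') := by
  have hshift (m m' : ℕ) (t : ℝ) (h : b m = b m') :
      circlePoint n (m + t) = circlePoint n (m' + t) := by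
    obtain ⟨k, hk⟩ := (hb m m').1 h
    have hk' : (m : ℝ) - m' = n * k := by exact_mod_cast hk
    exact (circlePoint_eq_iff (by lia)).2 ⟨k, by linear_combination hk'⟩
  have hne := ne_succ_of_eq_iff_dvd_sub (Nat.le_of_succ_le hn) hb
  constructor
  · refine eq_of_edgePoint_eq (fun m m' h => ?_) (hne i) (hne j) (fun h _ => hshift i j s h)
      fun h h' => ?_
    · simpa only [add_zero] using hshift m m' 0 h
    · have hdvd : (n : ℤ) ∣ 2 := by
        have hdvd := dvd_sub ((hb _ _).1 h') ((hb _ _).1 h)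
        rwa [show ((i + 1 : ℕ) - j - (i - (j + 1 : ℕ)) : ℤ) = 2 by lia] at hdvd
      have := Int.le_of_dvd two_pos hdvd
      lia
  · rw [circlePoint_eq_iff (by lia)]
    rintro ⟨k, hk⟩
    have hd : ((i - j - k * n : ℤ) : ℝ) = s' - s := by push_cast; linear_combination hk
    have hlow : -1 ≤ (i - j - k * n : ℤ) := by
      exact_mod_cast hd ▸ (by linarith [nonneg s', le_one s] : (-1 : ℝ) ≤ s' - s)
    have hhigh : (i - j - k * n : ℤ) ≤ 1 := by
      exact_mod_cast hd ▸ (by linarith [nonneg s, le_one s'] : (s' - s : ℝ) ≤ 1)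
    obtain h | h | h : (i - j - k * n : ℤ) = -1 ∨ (i - j - k * n : ℤ) = 0 ∨
        (i - j - k * n : ℤ) = 1 := by lia
    all_goals rw [h] at hd; push_cast at hd
    · rw [show (s : ℝ) = 1 by linarith [nonneg s', le_one s],
        show (s' : ℝ) = 0 by linarith [nonneg s', le_one s], edgePoint_one, edgePoint_zero,
        (hb (i + 1) j).2 ⟨k, by push_cast; linear_combination h⟩]
    · rw [show (s' : ℝ) = s by linarith, edgePoint, edgePoint,
        (hb i j).2 ⟨k, by linear_combination h⟩,
        (hb (i + 1) (j + 1)).2 ⟨k, by push_cast; linear_combination h⟩]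
    · rw [show (s : ℝ) = 0 by linarith [nonneg s, le_one s'],
        show (s' : ℝ) = 1 by linarith [nonneg s, le_one s'], edgePoint_one, edgePoint_zero,
        (hb i (j + 1)).2 ⟨k, by push_cast; linear_combination h⟩]

/-- The facets of the cone with apex `c` over the closed polygon with vertices `b i`, `i < n`. -/
def coneFacets (n : ℕ) (b : ℕ → V) (c : V) : Finset (Finset V) :=
  (Finset.range n).image fun i => {c, b i, b (i + 1)}

theorem exists_homeomorph_of_eq_iff_eq {X Y Z : Type*} [TopologicalSpace X] [TopologicalSpace Y]
    [TopologicalSpace Z] {f : X → Y} {g : X → Z} (hf : Topology.IsQuotientMap f)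
    (hg : Topology.IsQuotientMap g) (h : ∀ x y, f x = f y ↔ g x = g y) :
    ∃ e : Y ≃ₜ Z, ∀ x, e (f x) = g x := by
  have hf' : Topology.IsQuotientMap (⟨f, hf.continuous⟩ : C(X, Y)) := hf
  have hg' : Topology.IsQuotientMap (⟨g, hg.continuous⟩ : C(X, Z)) := hg
  have hfg : Function.FactorsThrough (⟨g, hg.continuous⟩ : C(X, Z)) f := fun x y => (h x y).1
  have hgf : Function.FactorsThrough (⟨f, hf.continuous⟩ : C(X, Y)) g := fun x y => (h x y).2
  let F := hf'.lift ⟨g, hg.continuous⟩ hfg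
  let G := hg'.lift ⟨f, hf.continuous⟩ hgf
  have hF (x : X) : F (f x) = g x := DFunLike.congr_fun (hf'.lift_comp _ hfg) x
  have hG (x : X) : G (g x) = f x := DFunLike.congr_fun (hg'.lift_comp _ hgf) x
  refine ⟨{ toFun := F
            invFun := G
            left_inv := hf.surjective.forall.2 fun x => by rw [hF, hG]
            right_inv := hg.surjective.forall.2 fun x => by rw [hG, hF]
            continuous_toFun := F.continuous
            continuous_invFun := G.continuous }, hF⟩

/-- The point over `circlePoint n (i + s)` at distance `r` from the centre of the unit disc. -/
noncomputable def discPoint (n : ℕ) (p : Fin n × I × I) : Metric.closedBall (0 : ℂ) 1 :=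
  ⟨((p.2.2 : ℝ) : ℂ) * circlePoint n ((p.1 : ℕ) + p.2.1), by
    simp [norm_circlePoint, abs_of_nonneg (nonneg p.2.2), le_one p.2.2]⟩

theorem isQuotientMap_discPoint {n : ℕ} (hn : n ≠ 0) : Topology.IsQuotientMap (discPoint n) := by
  refine .of_surjective_continuous (fun z => ?_) (Continuous.subtype_mk ?_ _)
  · obtain ⟨i, s, h⟩ := exists_circlePoint_eq hn z
    exact ⟨(i, s, ⟨‖(z : ℂ)‖, norm_nonneg _, mem_closedBall_zero_iff.1 z.2⟩), Subtype.ext h⟩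
  · have : Continuous fun i : Fin n => ((i : ℕ) : ℝ) := continuous_of_discreteTopology
    have := continuous_circlePoint n
    fun_prop

/-- The point of the cone with apex `c` dividing the segment from `c` to `edgePoint b i s` in the
ratio `r : 1 - r`. -/
noncomputable def conePoint (b : ℕ → V) (c : V) (i : ℕ) (s r : ℝ) : V → ℝ :=
  (1 - r) • Pi.single c 1 + r • edgePoint b i s

theorem conePoint_eq_iff {b : ℕ → V} {c : V} (hc : ∀ i, b i ≠ c) {i j : ℕ} {s s' r r' : ℝ} :
    conePoint b c i s r = conePoint b c j s' r' ↔
      r = r' ∧ (r = 0 ∨ edgePoint b i s = edgePoint b j s') := by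
  constructor
  · intro h
    have hapex := congrFun h c
    simp only [conePoint, Pi.add_apply, Pi.smul_apply, edgePoint_apply_eq_zero hc, smul_eq_mul,
      mul_zero, add_zero, Pi.single_eq_same, mul_one, sub_right_inj] at hapex
    subst hapex
    refine ⟨rfl, or_iff_not_imp_left.2 fun hr => smul_right_injective _ hr (add_left_cancel h)⟩
  · rintro ⟨rfl, rfl | h⟩
    · simp [conePoint]
    · rw [conePoint, conePoint, h]

theorem support_conePoint_subset (b : ℕ → V) (c : V) (i : ℕ) (s r : ℝ) :
    Function.support (conePoint b c i s r) ⊆ ({c, b i, b (i + 1)} : Finset V) := by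
  refine Function.support_subset_iff'.2 fun v hv => ?_
  simp only [Finset.mem_coe, Finset.mem_insert, Finset.mem_singleton, not_or] at hv
  simp [conePoint, edgePoint, hv.1, hv.2.1, hv.2.2]

theorem conePoint_mem_facetSpace [Fintype V] {n : ℕ} (b : ℕ → V) (c : V) (i : Fin n) (s r : I) :
    conePoint b c i s r ∈ facetSpace (coneFacets n b c) :=
  ⟨convex_stdSimplex ℝ V (single_mem_stdSimplex ℝ c) (edgePoint_mem_stdSimplex b i s)
    (one_minus_nonneg r) (nonneg r) (sub_add_cancel _ _), _,
    Finset.mem_image_of_mem _ (Finset.mem_range.2 i.2), support_conePoint_subset b c i s r⟩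

theorem exists_conePoint_eq [Fintype V] {n : ℕ} {b : ℕ → V} {c : V} (hc : ∀ i, b i ≠ c)
    (hb : ∀ i, b i ≠ b (i + 1)) {x : V → ℝ} (hx : x ∈ facetSpace (coneFacets n b c)) :
    ∃ (i : Fin n) (s r : I), conePoint b c i s r = x := by
  obtain ⟨⟨hpos, hsum⟩, t, ht, hxt⟩ := hx
  obtain ⟨i, hi, rfl⟩ := Finset.mem_image.1 ht
  have hout : ∀ v ∉ ({c, b i, b (i + 1)} : Finset V), x v = 0 := Function.support_subset_iff'.1 hxt
  have htotal : x c + (x (b i) + x (b (i + 1))) = 1 := by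
    rw [← hsum, ← Finset.sum_subset (Finset.subset_univ _) fun v _ => hout v,
      Finset.sum_insert (by simp [(hc _).symm]), Finset.sum_pair (hb i)]
  set r := x (b i) + x (b (i + 1))
  have hsr : x (b (i + 1)) / r * r = x (b (i + 1)) :=
    div_mul_cancel_of_imp fun h => by linarith [hpos (b i), hpos (b (i + 1))]
  have hr0 : 0 ≤ r := add_nonneg (hpos _) (hpos _)
  refine ⟨⟨i, Finset.mem_range.1 hi⟩, ⟨x (b (i + 1)) / r, div_nonneg (hpos _) hr0,
    div_le_one_of_le₀ (by linarith [hpos (b i)]) hr0⟩, ⟨r, hr0, by linarith [hpos c]⟩, ?_⟩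
  funext v
  by_cases hv : v ∈ ({c, b i, b (i + 1)} : Finset V)
  · simp only [Finset.mem_insert, Finset.mem_singleton] at hv
    obtain rfl | rfl | rfl := hv
    · simp only [conePoint, edgePoint, smul_add, Pi.add_apply, Pi.smul_apply, Pi.single_eq_same,
        smul_eq_mul, mul_one, ne_eq, (hc _).symm, not_false_eq_true, Pi.single_eq_of_ne, mul_zero,
        add_zero]
      linarith
    · simp only [conePoint, edgePoint, smul_add, Pi.add_apply, Pi.smul_apply, ne_eq, hc,
        not_false_eq_true, Pi.single_eq_of_ne, smul_eq_mul, mul_zero, Pi.single_eq_same, hb,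
        add_zero, zero_add]
      linarith
    · simp only [conePoint, edgePoint, smul_add, Pi.add_apply, Pi.smul_apply, ne_eq, hc,
        not_false_eq_true, Pi.single_eq_of_ne, smul_eq_mul, mul_zero, (hb i).symm,
        Pi.single_eq_same, zero_add]
      linarith
  · exact (Function.notMem_support.1 fun h => hv (support_conePoint_subset _ _ _ _ _ h)).trans
      (hout v hv).symm

theorem isQuotientMap_conePoint [Fintype V] {n : ℕ} {b : ℕ → V} {c : V} (hc : ∀ i, b i ≠ c)
    (hb : ∀ i, b i ≠ b (i + 1)) :
    Topology.IsQuotientMap fun p : Fin n × I × I =>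
      (⟨_, conePoint_mem_facetSpace b c p.1 p.2.1 p.2.2⟩ : facetSpace (coneFacets n b c)) := by
  refine .of_surjective_continuous (fun x => ?_) (Continuous.subtype_mk ?_ _)
  · obtain ⟨i, s, r, h⟩ := exists_conePoint_eq hc hb x.2
    exact ⟨(i, s, r), Subtype.ext h⟩
  · refine continuous_prod_of_discrete_left.2 fun i => ?_
    have hsingle (v : V) : Continuous (fun r : ℝ => (Pi.single v r : V → ℝ)) :=
      continuous_single (A := fun _ => ℝ) v
    have hedge : Continuous fun p : I × I => edgePoint b i p.1 :=
      ((hsingle _).comp (by fun_prop)).add ((hsingle _).comp (by fun_prop))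
    have hscale : Continuous fun p : I × I => (p.2 : ℝ) := by fun_prop
    have hapex : Continuous fun p : I × I => (1 - (p.2 : ℝ)) • (Pi.single c 1 : V → ℝ) := by
      fun_prop
    exact hapex.add (hscale.smul hedge)

theorem discPoint_eq_iff {n : ℕ} {p p' : Fin n × I × I} :
    discPoint n p = discPoint n p' ↔ (p.2.2 : ℝ) = p'.2.2 ∧ ((p.2.2 : ℝ) = 0 ∨
      circlePoint n ((p.1 : ℕ) + p.2.1) = circlePoint n ((p'.1 : ℕ) + p'.2.1)) := by
  rw [Subtype.ext_iff]
  constructor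
  · intro h
    have hnorm := congrArg norm h
    simp only [discPoint, norm_mul, norm_circlePoint, Complex.norm_real, Real.norm_eq_abs,
      abs_of_nonneg (nonneg _), mul_one] at hnorm
    refine ⟨hnorm, ?_⟩
    simp only [discPoint, ← hnorm, mul_eq_mul_left_iff, Complex.ofReal_eq_zero] at h
    exact h.symm
  · rintro ⟨h, h0 | h'⟩
    · simp [discPoint, ← h, h0]
    · simp only [discPoint, h, h']

theorem exists_homeomorph_coneFacets [Fintype V] {n : ℕ} (hn : 3 ≤ n) {b : ℕ → V} {c : V}
    (hb : ∀ i j, b i = b j ↔ (n : ℤ) ∣ i - j) (hc : ∀ i, b i ≠ c) :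
    ∃ e : Metric.closedBall (0 : ℂ) 1 ≃ₜ facetSpace (coneFacets n b c),
      (∀ z, (e z : V → ℝ) c = 1 - ‖(z : ℂ)‖) ∧
      ∀ (i : Fin n) (s : I) (z : Metric.closedBall (0 : ℂ) 1),
        (z : ℂ) = circlePoint n ((i : ℕ) + s) → (e z : V → ℝ) = edgePoint b i s := by
  have hne := ne_succ_of_eq_iff_dvd_sub (Nat.le_of_succ_le hn) hb
  have hquot := isQuotientMap_discPoint (n := n) (by lia)
  obtain ⟨e, he⟩ := exists_homeomorph_of_eq_iff_eq hquot (isQuotientMap_conePoint hc hne)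
    fun p p' => by
      rw [discPoint_eq_iff, Subtype.ext_iff, conePoint_eq_iff hc,
        edgePoint_eq_iff_circlePoint_eq hn hb]
  refine ⟨e, fun z => ?_, fun i s z hz => ?_⟩
  · obtain ⟨⟨i, s, r⟩, rfl⟩ := hquot.surjective z
    rw [he]
    simp [conePoint, edgePoint_apply_eq_zero hc, discPoint, norm_circlePoint, abs_of_nonneg,
      nonneg r]
  · obtain rfl : discPoint n (i, s, 1) = z := Subtype.ext (by simp [discPoint, hz])
    rw [he]
    simp [conePoint]

end Cone

section Surface

open unitInterval

theorem exists_eq_natCast_add_of_mem_Icc {n : ℕ} (hn : n ≠ 0) {u : ℝ}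
    (hu : u ∈ Set.Icc (0 : ℝ) n) : ∃ i < n, ∃ s : I, u = i + s := by
  obtain ⟨h0, hn'⟩ := hu
  rcases hn'.eq_or_lt with rfl | hlt
  · exact ⟨n - 1, by lia, 1, by simp [Nat.cast_sub (Nat.one_le_iff_ne_zero.2 hn)]⟩
  · exact ⟨⌊u⌋₊, (Nat.floor_lt h0).2 hlt, ⟨u - ⌊u⌋₊, sub_nonneg.2 (Nat.floor_le h0),
      (sub_lt_iff_lt_add'.2 (Nat.lt_floor_add_one u)).le⟩, (add_sub_cancel _ _).symm⟩

theorem crosscapGluing_iff_circlePoint {h : ℕ} {z w : Metric.closedBall (0 : ℂ) 1} :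
    crosscapGluing h z w ↔ ∃ i < 6 * h, i % 6 < 3 ∧ ∃ s : I,
      (z : ℂ) = circlePoint (6 * h) (i + s) ∧ (w : ℂ) = circlePoint (6 * h) ((i + 3 : ℕ) + s) := by
  have hangle (u t : ℝ) (hh : h ≠ 0) (hu : u = 3 * t) :
      2 * Real.pi * u / (6 * h : ℕ) = Real.pi * t / h := by
    rw [hu]
    push_cast
    field_simp
    ring
  constructor
  · rintro ⟨k, hk, t, h0, h1, hz, hw⟩
    have hh : h ≠ 0 := by lia
    obtain ⟨a, ha, s, hs⟩ := exists_eq_natCast_add_of_mem_Icc three_ne_zero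
      (u := 3 * t) ⟨by linarith, by push_cast; linarith⟩
    refine ⟨6 * k + a, by lia, by lia, s, ?_, ?_⟩
    · rw [hz, circlePoint, hangle _ (2 * k + t) hh (by push_cast; linarith)]
    · rw [hw, circlePoint, hangle _ (2 * k + 1 + t) hh (by push_cast; linarith)]
  · rintro ⟨i, hi, ha, s, hz, hw⟩
    have hh : h ≠ 0 := by lia
    obtain ⟨k, a, hk, ha', rfl⟩ : ∃ k a, k < h ∧ a ≤ 2 ∧ i = 6 * k + a :=
      ⟨i / 6, i % 6, by lia, by lia, by lia⟩
    have hs : (a : ℝ) + s ≤ 3 := by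
      linarith [show (a : ℝ) ≤ 2 from mod_cast ha', le_one s]
    refine ⟨k, hk, (a + s) / 3, div_nonneg (add_nonneg a.cast_nonneg (nonneg s)) (by norm_num),
      by linarith, ?_, ?_⟩
    · rw [hz, circlePoint, hangle _ (2 * k + (a + s) / 3) hh (by push_cast; ring)]
    · rw [hw, circlePoint, hangle _ (2 * k + 1 + (a + s) / 3) hh (by push_cast; ring)]

/-- The image in `NonorientableSurface h` of the boundary point `circlePoint (6 * h) u` of the
disc, so that each side of the polygon has length `3`. -/
noncomputable def boundaryClass (h : ℕ) (u : ℝ) : NonorientableSurface h :=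
  Quot.mk _ ⟨circlePoint (6 * h) u, by simp [norm_circlePoint]⟩

theorem boundaryClass_eq_add_three {h i : ℕ} (hi : i < 6 * h) (hi' : i % 6 < 3) (s : I) :
    boundaryClass h (i + s) = boundaryClass h ((i + 3 : ℕ) + s) :=
  Quot.sound (crosscapGluing_iff_circlePoint.2 ⟨i, hi, hi', s, rfl, rfl⟩)

theorem boundaryClass_three_mul {h m : ℕ} (hm : m ≤ 2 * h) :
    boundaryClass h (3 * m : ℕ) = boundaryClass h 0 := by
  induction m with
  | zero => simp
  | succ m ih =>
    rw [← ih (by lia)]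
    obtain ⟨k, rfl | rfl⟩ := m.even_or_odd'
    · have hside := boundaryClass_eq_add_three (h := h) (i := 6 * k) (by lia) (by lia) 0
      convert hside.symm using 2 <;> push_cast <;> ring
    · have hside := boundaryClass_eq_add_three (h := h) (i := 6 * k + 2) (by lia) (by lia) 1
      convert hside.symm using 2 <;> push_cast <;> ring

theorem boundaryClass_mod {h : ℕ} (hh : h ≠ 0) (i : ℕ) :
    boundaryClass h (i % (6 * h) : ℕ) = boundaryClass h i := by
  obtain ⟨q, hq⟩ : ∃ q, i = i % (6 * h) + q * (6 * h) := ⟨_, (Nat.mod_add_div' _ _).symm⟩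
  refine congrArg (Quot.mk _) (Subtype.ext ((circlePoint_eq_iff (by lia)).2 ⟨-q, ?_⟩))
  nth_rewrite 2 [hq]
  push_cast
  ring

/-- The vertex number `i`, counted cyclically, on the boundary of the disc triangulated by
`polygonFacets`. -/
def boundaryVertex (i : ℕ) : Fin 37 := Fin.ofNat 37 (i % 24)

/-- The vertex number `j`, counted cyclically, of the inner ring of `polygonFacets`. -/
def ringVertex (j : ℕ) : Fin 37 := Fin.ofNat 37 (24 + j % 12)

/-- The facets of a triangulation of the disc with `24` boundary vertices, the central vertex `36`
and a ring of `12` vertices in between. -/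
def polygonFacets : Finset (Finset (Fin 37)) :=
  (Finset.range 12).biUnion fun j =>
    {{ringVertex j, boundaryVertex (2 * j), boundaryVertex (2 * j + 1)},
      {ringVertex j, boundaryVertex (2 * j + 1), boundaryVertex (2 * j + 2)},
      {ringVertex j, ringVertex (j + 1), boundaryVertex (2 * j + 2)},
      {36, ringVertex j, ringVertex (j + 1)}}

/-- Bistellar moves that remove the inner ring of `polygonFacets`. -/
def ringRemoval : List (Finset (Fin 37)) :=
  (List.range 12).map (fun j => {ringVertex j, ringVertex (j + 1)}) ++
    (List.range 12).flatMap fun j => [{ringVertex j, boundaryVertex (2 * j)}, {ringVertex j}]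

theorem movesTo_coneFacets :
    MovesTo ringRemoval polygonFacets (coneFacets 24 boundaryVertex 36) := by
  decide +kernel

theorem le_ringVertex (j : ℕ) : 24 ≤ ringVertex j := by
  simp only [ringVertex, Fin.le_def, Fin.val_ofNat]
  change 24 ≤ (24 + j % 12) % 37
  lia

theorem exists_mem_of_mem_ringRemoval {A : Finset (Fin 37)} (hA : A ∈ ringRemoval) :
    ∃ v ∈ A, 24 ≤ v := by
  obtain ⟨j, hj⟩ : ∃ j, ringVertex j ∈ A := by
    simp only [ringRemoval, List.mem_append, List.mem_map, List.mem_flatMap, List.mem_cons,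
      List.not_mem_nil, or_false] at hA
    rcases hA with ⟨j, -, rfl⟩ | ⟨j, -, rfl | rfl⟩ <;> exact ⟨j, by simp⟩
  exact ⟨_, hj, le_ringVertex j⟩

theorem boundaryVertex_eq_iff (i j : ℕ) :
    boundaryVertex i = boundaryVertex j ↔ ((24 : ℕ) : ℤ) ∣ i - j := by
  simp only [boundaryVertex, Fin.ext_iff, Fin.val_ofNat]
  lia

theorem boundaryVertex_lt (i : ℕ) : boundaryVertex i < 24 := by
  simp only [boundaryVertex, Fin.lt_def, Fin.val_ofNat]
  change i % 24 % 37 < 24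
  lia

/-- The vertex of the triangulated surface to which a vertex of `polygonFacets` is glued: the ends
of all sides become the vertex `0`. -/
def gluedVertex (v : Fin 37) : Fin 22 :=
  if 24 ≤ v then (if v = 36 then 9 else Fin.ofNat 22 (v - 14))
  else if v.1 % 3 = 0 then 0 else Fin.ofNat 22 (2 * (v / 6) + v % 3)

/-- The facets of a triangulation of `N₄`. -/
def surfaceFacets : Finset (Finset (Fin 22)) := polygonFacets.image (Finset.image gluedVertex)

theorem exists_homeomorph_polygonFacets :
    ∃ e : Metric.closedBall (0 : ℂ) 1 ≃ₜ facetSpace polygonFacets,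
      (∀ z, (∀ v, 24 ≤ v → (e z : Fin 37 → ℝ) v = 0) →
        ∃ (i : Fin 24) (s : I), (z : ℂ) = circlePoint 24 ((i : ℕ) + s)) ∧
      ∀ (i : Fin 24) (s : I) (z : Metric.closedBall (0 : ℂ) 1),
        (z : ℂ) = circlePoint 24 ((i : ℕ) + s) →
          (e z : Fin 37 → ℝ) = edgePoint boundaryVertex i s := by
  have hapex (v : Fin 37) (hv : 24 ≤ v) (i : ℕ) : boundaryVertex i ≠ v :=
    ((boundaryVertex_lt i).trans_le hv).ne
  obtain ⟨eC, hnorm, hedge⟩ := exists_homeomorph_coneFacets (by norm_num) boundaryVertex_eq_iff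
    (hapex 36 (by decide))
  obtain ⟨eM, heM⟩ := movesTo_coneFacets.exists_homeomorph
  have hfix (x : facetSpace polygonFacets) (hx : ∀ v, 24 ≤ v → (x : Fin 37 → ℝ) v = 0) :
      (eM x : Fin 37 → ℝ) = x :=
    heM x fun A hA => (exists_mem_of_mem_ringRemoval hA).imp fun a ha => ⟨ha.1, hx a ha.2⟩
  refine ⟨eC.trans eM.symm, fun z hz => ?_, fun i s z hz => ?_⟩
  · have hzero := hz 36 (by decide)
    rw [← hfix _ hz, Homeomorph.trans_apply, Homeomorph.apply_symm_apply, hnorm,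
      sub_eq_zero] at hzero
    obtain ⟨i, s, hzis⟩ := exists_circlePoint_eq (n := 24) (by norm_num) (z : ℂ)
    exact ⟨i, s, by rw [← hzis, ← hzero, Complex.ofReal_one, one_mul]⟩
  · have hmem : edgePoint boundaryVertex i s ∈ facetSpace polygonFacets := by
      refine ⟨edgePoint_mem_stdSimplex _ _ _, ?_⟩
      have hfacet : ∀ i : Fin 24, (polygonFacets.filter fun t =>
          boundaryVertex i ∈ t ∧ boundaryVertex (i + 1) ∈ t).Nonempty := by
        decide +kernel
      obtain ⟨t, ht⟩ := hfacet i
      obtain ⟨ht, hi, hi'⟩ := Finset.mem_filter.1 ht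
      refine ⟨t, ht, Function.support_subset_iff'.2 fun v hv => ?_⟩
      have hvi : v ≠ boundaryVertex i := fun h => hv (h ▸ hi)
      have hvi' : v ≠ boundaryVertex (i + 1) := fun h => hv (h ▸ hi')
      simp [edgePoint, hvi, hvi']
    have hfixed : eM ⟨_, hmem⟩ = eC z := Subtype.ext <|
      (hfix ⟨_, hmem⟩ fun v hv => edgePoint_apply_eq_zero (hapex v hv) i s).trans
        (hedge i s z hz).symm
    rw [Homeomorph.trans_apply, ← hfixed, Homeomorph.symm_apply_apply]

theorem eq_of_facetSpaceMap_gluedVertex_eq {v : Fin 37} (hv : 24 ≤ v)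
    {x y : facetSpace polygonFacets} (hx : (x : Fin 37 → ℝ) v ≠ 0)
    (hxy : facetSpaceMap gluedVertex polygonFacets x = facetSpaceMap gluedVertex polygonFacets y) :
    x = y := by
  have hstar : ∀ v : Fin 37, 24 ≤ v →
      (((polygonFacets.filter (v ∈ ·)).sup id).image gluedVertex).card =
        ((polygonFacets.filter (v ∈ ·)).sup id).card := by
    decide +kernel
  have hinj : ∀ v : Fin 37, 24 ≤ v → ∀ w, gluedVertex w = gluedVertex v → w = v := by
    decide +kernel
  refine eq_of_facetSpaceMap_eq ((Finset.card_image_iff.1 (hstar v hv)).mono ?_) (hinj v hv) hx hxy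
  rintro w ⟨t, ht, hvt, hwt⟩
  exact Finset.mem_sup.2 ⟨t, Finset.mem_filter.2 ⟨ht, hvt⟩, hwt⟩

/-- The vertex of `surfaceFacets` to which the vertex number `i` on the boundary of the disc is
glued. -/
def boundaryLabel (i : ℕ) : Fin 22 := gluedVertex (boundaryVertex i)

theorem edgePoint_boundaryLabel_eq_add_three {i : Fin 24} (hi : i.1 % 6 < 3) (s : ℝ) :
    edgePoint boundaryLabel i s = edgePoint boundaryLabel (i + 3 : ℕ) s := by
  have hside : ∀ i : Fin 24, i.1 % 6 < 3 → boundaryLabel i = boundaryLabel (i + 3) ∧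
      boundaryLabel (i + 1) = boundaryLabel (i + 3 + 1) := by
    decide +kernel
  rw [edgePoint, edgePoint, (hside i hi).1, (hside i hi).2]

theorem boundaryClass_eq_of_boundaryLabel_eq {i j : ℕ}
    (h : boundaryLabel i = boundaryLabel j) :
    boundaryClass 4 i = boundaryClass 4 j := by
  have hlabel : ∀ i j : Fin 24, boundaryLabel i = boundaryLabel j →
      i.1 % 3 = 0 ∧ j.1 % 3 = 0 ∨ i = j ∨ i.1 % 6 < 3 ∧ j.1 = i + 3 ∨
        j.1 % 6 < 3 ∧ i.1 = j + 3 := by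
    decide +kernel
  have hside (i j : ℕ) (hi : i < 24) (h : i % 6 < 3 ∧ j = i + 3) :
      boundaryClass 4 i = boundaryClass 4 j := by
    simpa only [h.2, Set.Icc.coe_zero, add_zero] using
      boundaryClass_eq_add_three (h := 4) hi h.1 0
  have hcorner (i : ℕ) (hi : i < 24) (h : i % 3 = 0) : boundaryClass 4 i = boundaryClass 4 0 := by
    obtain ⟨m, rfl⟩ := Nat.dvd_of_mod_eq_zero h
    exact boundaryClass_three_mul (by lia)
  have hmod (i : ℕ) : boundaryLabel i = boundaryLabel (i % 24) := by
    simp only [boundaryLabel, boundaryVertex, Nat.mod_mod]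
  have hi : i % 24 < 24 := Nat.mod_lt _ (by norm_num)
  have hj : j % 24 < 24 := Nat.mod_lt _ (by norm_num)
  rw [hmod i, hmod j] at h
  rw [← boundaryClass_mod four_ne_zero i, ← boundaryClass_mod four_ne_zero j]
  rcases hlabel ⟨_, hi⟩ ⟨_, hj⟩ h with ⟨h3, h3'⟩ | heq | hij | hji
  · exact (hcorner _ hi h3).trans (hcorner _ hj h3').symm
  · exact congrArg (fun k : ℕ => boundaryClass 4 k) (congrArg Fin.val heq)
  · exact hside _ _ hi hij
  · exact (hside _ _ hj hji).symm

theorem boundaryClass_eq_of_edgePoint_eq {i j : Fin 24} {s s' : I}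
    (h : edgePoint boundaryLabel i s =
      edgePoint boundaryLabel j s') :
    boundaryClass 4 ((i : ℕ) + s) = boundaryClass 4 ((j : ℕ) + s') := by
  have hne : ∀ i : Fin 24, boundaryLabel i ≠ boundaryLabel (i + 1) := by
    decide +kernel
  have hsame : ∀ i j : Fin 24, boundaryLabel i = boundaryLabel j →
      boundaryLabel (i + 1) = boundaryLabel (j + 1) →
      i = j ∨ i.1 % 6 < 3 ∧ j.1 = i + 3 ∨ j.1 % 6 < 3 ∧ i.1 = j + 3 := by
    decide +kernel
  have hreversed : ∀ i j : Fin 24,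
      boundaryLabel i = boundaryLabel (j + 1) →
      boundaryLabel (i + 1) ≠ boundaryLabel j := by
    decide +kernel
  refine eq_of_edgePoint_eq (fun _ _ => boundaryClass_eq_of_boundaryLabel_eq) (hne i) (hne j)
    (fun h0 h1 => ?_) (hreversed i j) h
  rcases hsame i j h0 h1 with rfl | ⟨h6, hj⟩ | ⟨h6, hi⟩
  · rfl
  · rw [hj]
    exact boundaryClass_eq_add_three i.2 h6 s
  · rw [hi]
    exact (boundaryClass_eq_add_three j.2 h6 s).symm

theorem nonempty_homeomorph_surfaceFacets :
    Nonempty (NonorientableSurface 4 ≃ₜ facetSpace surfaceFacets) := by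
  obtain ⟨e, hcircle, hedge⟩ := exists_homeomorph_polygonFacets
  have : CompactSpace (facetSpace polygonFacets) :=
    isCompact_iff_compactSpace.1 (isCompact_facetSpace _)
  let g z := facetSpaceMap gluedVertex polygonFacets (e z)
  have hg : Topology.IsQuotientMap g := .of_surjective_continuous
    ((facetSpaceMap_surjective _ _).comp e.surjective)
    ((continuous_facetSpaceMap _ _).comp e.continuous)
  have hboundary (i : Fin 24) (s : I) (z : Metric.closedBall (0 : ℂ) 1)
      (hz : (z : ℂ) = circlePoint 24 ((i : ℕ) + s)) :
      (g z : Fin 22 → ℝ) = edgePoint boundaryLabel i s := by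
    simp only [g, facetSpaceMap, hedge i s z hz, edgePoint, map_add, boundaryLabel,
      FunOnFinite.linearMap_piSingle]
  have hglue (z w) (hzw : crosscapGluing 4 z w) : g z = g w := by
    obtain ⟨i, hi, hi', s, hz, hw⟩ := crosscapGluing_iff_circlePoint.1 hzw
    apply Subtype.ext
    rw [hboundary ⟨i, hi⟩ s z hz, hboundary ⟨i + 3, by lia⟩ s w hw,
      edgePoint_boundaryLabel_eq_add_three hi']
  have hker (z w) (h : g z = g w) : Quot.mk (crosscapGluing 4) z = Quot.mk _ w := by
    by_cases hz : ∃ v, 24 ≤ v ∧ (e z : Fin 37 → ℝ) v ≠ 0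
    · obtain ⟨v, hv, hzv⟩ := hz
      rw [e.injective (eq_of_facetSpaceMap_gluedVertex_eq hv hzv h)]
    by_cases hw : ∃ v, 24 ≤ v ∧ (e w : Fin 37 → ℝ) v ≠ 0
    · obtain ⟨v, hv, hwv⟩ := hw
      rw [e.injective (eq_of_facetSpaceMap_gluedVertex_eq hv hwv h.symm)]
    push Not at hz hw
    obtain ⟨i, s, hzis⟩ := hcircle z hz
    obtain ⟨j, s', hwjs⟩ := hcircle w hw
    have hclass := boundaryClass_eq_of_edgePoint_eq
      ((hboundary i s z hzis).symm.trans ((congrArg Subtype.val h).trans (hboundary j s' w hwjs)))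
    simpa only [boundaryClass, ← hzis, ← hwjs] using hclass
  exact (exists_homeomorph_of_eq_iff_eq isQuotientMap_quot_mk hg fun z w =>
    ⟨fun h => congrArg (Quot.lift g hglue) h, hker z w⟩).nonempty

end Surface

section Automorphisms

variable {V : Type} [Fintype V] {K L : AbstractSimplicialComplex V} {ψ : V → Space3}
  {σ : Equiv.Perm V} {R : Space3 ≃ᵃⁱ[ℝ] Space3}

theorem comp_symm_mem_geomRealization (hσ : IsComplexIso K L σ) {x : V → ℝ}
    (hx : x ∈ geomRealization K) : x ∘ σ.symm ∈ geomRealization L := by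
  classical
  refine ⟨⟨fun v => hx.1.1 _, (Equiv.sum_comp σ.symm x).trans hx.1.2⟩, ?_⟩
  convert (hσ _).1 hx.2 using 1
  ext v
  simp [Finset.mem_map_equiv]

theorem simplexwiseLinear_comp_symm (hψ : ∀ v, ψ (σ v) = R (ψ v)) {x : V → ℝ}
    (hx : ∑ v, x v = 1) : simplexwiseLinear ψ (x ∘ σ.symm) = R (simplexwiseLinear ψ x) := by
  have hlin := fun φ : V → Space3 =>
    Finset.univ.affineCombination_eq_linear_combination (k := ℝ) φ
  calc simplexwiseLinear ψ (x ∘ σ.symm) = ∑ v, x v • R (ψ v) := by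
        rw [simplexwiseLinear, ← Equiv.sum_comp σ]
        simp only [Function.comp_apply, Equiv.symm_apply_apply, hψ]
    _ = R (simplexwiseLinear ψ x) := by
        rw [simplexwiseLinear, ← hlin ψ x hx, ← hlin (fun v => R (ψ v)) x hx]
        exact (Finset.map_affineCombination _ ψ x hx R.toAffineEquiv.toAffineMap).symm

theorem isGeometricSymmetry_of_isComplexIso (hσ : IsComplexIso K K σ)
    (hψ : ∀ v, ψ (σ v) = R (ψ v)) : IsGeometricSymmetry K ψ R := by
  have hcomm : ∀ x ∈ geomRealization K,
      R (simplexwiseLinear ψ x) = simplexwiseLinear ψ (x ∘ σ.symm) := fun x hx =>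
    (simplexwiseLinear_comp_symm hψ hx.1.2).symm
  have hσ' : IsComplexIso K K σ.symm := fun s => by
    rw [hσ (s.map σ.symm.toEmbedding), Finset.map_map, ← Equiv.trans_toEmbedding,
      Equiv.symm_trans_self, Equiv.refl_toEmbedding, Finset.map_refl]
  refine ⟨Set.Subset.antisymm ?_ ?_, σ, hσ, hcomm⟩
  · rintro _ ⟨_, ⟨x, hx, rfl⟩, rfl⟩
    exact ⟨_, comp_symm_mem_geomRealization hσ hx, (hcomm x hx).symm⟩
  · rintro _ ⟨x, hx, rfl⟩
    have hx' := comp_symm_mem_geomRealization hσ' hx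
    refine ⟨_, ⟨_, hx', rfl⟩, (hcomm _ hx').trans ?_⟩
    simp [Function.comp_assoc]

theorem injOn_openStar_of_isComplexIso (hσ : IsComplexIso K K σ) (hψ : ∀ v, ψ (σ v) = R (ψ v))
    {v : V} (hinj : Set.InjOn (simplexwiseLinear ψ) (geomRealization K ∩ {x | x (σ v) ≠ 0})) :
    Set.InjOn (simplexwiseLinear ψ) (geomRealization K ∩ {x | x v ≠ 0}) := by
  rintro x ⟨hx, hxv⟩ y ⟨hy, hyv⟩ hxy
  refine σ.symm.surjective.injective_comp_right
    (hinj ⟨comp_symm_mem_geomRealization hσ hx, ?_⟩ ⟨comp_symm_mem_geomRealization hσ hy, ?_⟩ ?_)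
  · simpa using hxv
  · simpa using hyv
  · rw [simplexwiseLinear_comp_symm hψ hx.1.2, simplexwiseLinear_comp_symm hψ hy.1.2, hxy]

theorem isPolyhedralImmersion_of_injOn_openStar
    (hinj : ∀ v, Set.InjOn (simplexwiseLinear ψ) (geomRealization K ∩ {x | x v ≠ 0})) :
    IsPolyhedralImmersion K ψ := by
  intro x
  obtain ⟨v, hv⟩ : ∃ v, (x : V → ℝ) v ≠ 0 := by
    by_contra! hzero
    exact zero_ne_one ((Finset.sum_eq_zero fun v _ => hzero v).symm.trans x.2.1.2)
  refine ⟨{y | (y : V → ℝ) v ≠ 0}, IsOpen.mem_nhds ?_ hv, fun y hy z hz hyz =>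
    Subtype.ext (hinj v ⟨y.2, hy⟩ ⟨z.2, hz⟩ hyz)⟩
  exact isOpen_ne_fun ((continuous_apply v).comp continuous_subtype_val) continuous_const

end Automorphisms

section PureComplexes

variable {V : Type} {T T' : Finset (Finset V)} {σ : Equiv.Perm V}

theorem isComplexIso_facetComplex (hT : ∀ v, ∃ t ∈ T, v ∈ t)
    (hσ : ∀ t ∈ T, t.map σ.toEmbedding ∈ T) :
    IsComplexIso (facetComplex T hT) (facetComplex T hT) σ := by
  classical
  have himage : T.map (Finset.mapEmbedding σ.toEmbedding).toEmbedding = T :=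
    Finset.eq_of_subset_of_card_le (fun s hs => by
      obtain ⟨t, ht, rfl⟩ := Finset.mem_map.1 hs
      exact hσ t ht) (Finset.card_map _).ge
  intro s
  rw [mem_facetComplex, mem_facetComplex, Finset.map_nonempty]
  refine and_congr_right fun _ => ⟨fun ⟨t, ht, hst⟩ => ⟨_, hσ t ht, Finset.map_subset_map.2 hst⟩,
    fun ⟨t, ht, hst⟩ => ?_⟩
  obtain ⟨t, ht', rfl⟩ := Finset.mem_map.1 (himage.symm ▸ ht)
  exact ⟨t, ht', Finset.map_subset_map.1 hst⟩

theorem mem_iff_mem_facetComplex_and_card {hT : ∀ v, ∃ t ∈ T, v ∈ t}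
    (hcard : ∀ t ∈ T, t.card = 3) (s : Finset V) : s ∈ T ↔ s ∈ facetComplex T hT ∧ s.card = 3 := by
  refine ⟨fun hs => ⟨⟨Finset.card_pos.1 (by simp [hcard s hs]), s, hs, subset_rfl⟩, hcard s hs⟩, ?_⟩
  rintro ⟨⟨-, t, ht, hst⟩, hs⟩
  exact Finset.eq_of_subset_of_card_le hst (by rw [hcard t ht, hs]) ▸ ht

theorem isTriangulationOf_facetComplex [Fintype V] [Nonempty V] (hT : ∀ v, ∃ t ∈ T, v ∈ t)
    (hcard : ∀ t ∈ T, t.card = 3) {S : Type} [TopologicalSpace S]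
    (hS : Nonempty (facetSpace T ≃ₜ S)) : IsTriangulationOf (facetComplex T hT) S := by
  refine ⟨fun s ⟨_, t, ht, hst⟩ => hcard t ht ▸ Finset.card_le_card hst, ?_, ?_⟩
  · obtain ⟨t, ht, -⟩ := hT (Classical.arbitrary V)
    exact ⟨t, (mem_iff_mem_facetComplex_and_card hcard t).1 ht⟩
  · rwa [geomRealization_facetComplex]

end PureComplexes

section ColourInvariant

variable {V : Type*} [DecidableEq V] {T T' : Finset (Finset V)} {σ : Equiv.Perm V}

/-- A refinement of a colouring of the vertices of the complex with facets `T`. -/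
def refineColour (T : Finset (Finset V)) (c : V → ℕ) (v : V) : ℕ :=
  ∑ t ∈ T with v ∈ t, (∑ w ∈ t, c w) ^ 2

/-- An isomorphism invariant of the complex with facets `T`: every vertex is singled out in turn by
an initial colouring, and its colours after three refinements are added up. -/
def colourInvariant [Fintype V] (T : Finset (Finset V)) : ℕ :=
  ∑ u, (refineColour T)^[3] (fun v => if v = u then 0 else 1) u

theorem refineColour_comp (hσ : ∀ t, t ∈ T ↔ t.map σ.toEmbedding ∈ T') (c : V → ℕ) :
    refineColour T' c ∘ σ = refineColour T (c ∘ σ) := by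
  funext v
  refine (Finset.sum_equiv σ.finsetCongr (fun t => ?_) fun t _ => ?_).symm
  · simp [hσ t]
  · simp [Finset.sum_map]

theorem colourInvariant_eq [Fintype V] (hσ : ∀ t, t ∈ T ↔ t.map σ.toEmbedding ∈ T') :
    colourInvariant T = colourInvariant T' := by
  have hiterate (c : V → ℕ) (k : ℕ) :
      (refineColour T')^[k] c ∘ σ = (refineColour T)^[k] (c ∘ σ) := by
    induction k with
    | zero => rfl
    | succ k ih =>
      rw [Function.iterate_succ_apply', Function.iterate_succ_apply', refineColour_comp hσ, ih]
  refine Fintype.sum_equiv σ _ _ fun u => ?_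
  rw [← Function.comp_apply (f := (refineColour T')^[3] _) (g := σ), hiterate]
  simp only [Function.comp_def, σ.injective.eq_iff]

end ColourInvariant

theorem colourInvariant_eq_of_isomorphic {V : Type} [Fintype V] [DecidableEq V]
    {T T' : Finset (Finset V)} {hT : ∀ v, ∃ t ∈ T, v ∈ t} {hT' : ∀ v, ∃ t ∈ T', v ∈ t}
    (hcard : ∀ t ∈ T, t.card = 3) (hcard' : ∀ t ∈ T', t.card = 3)
    (h : Isomorphic (facetComplex T hT) (facetComplex T' hT')) :
    colourInvariant T = colourInvariant T' := by
  obtain ⟨σ, hσ⟩ := h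
  refine colourInvariant_eq (σ := σ) fun t => ?_
  rw [mem_iff_mem_facetComplex_and_card (hT := hT) hcard,
    mem_iff_mem_facetComplex_and_card (hT := hT') hcard', hσ, Finset.card_map]

section TripleProduct

/-- The cross product of integer vectors. -/
def crossProd (a b : ℤ × ℤ × ℤ) : ℤ × ℤ × ℤ :=
  (a.2.1 * b.2.2 - a.2.2 * b.2.1, a.2.2 * b.1 - a.1 * b.2.2, a.1 * b.2.1 - a.2.1 * b.1)

/-- The determinant of three integer vectors. -/
def tripleProd (a b c : ℤ × ℤ × ℤ) : ℤ :=
  (crossProd a b).1 * c.1 + ((crossProd a b).2.1 * c.2.1 + (crossProd a b).2.2 * c.2.2)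

/-- The point of space with the given integer coordinates. -/
noncomputable def intPoint (p : ℤ × ℤ × ℤ) : Space3 := !₂[(p.1 : ℝ), (p.2.1 : ℝ), (p.2.2 : ℝ)]

theorem intPoint_sub (p q : ℤ × ℤ × ℤ) : intPoint (p - q) = intPoint p - intPoint q := by
  ext i
  fin_cases i <;> simp [intPoint]

variable {a b c d : ℤ × ℤ × ℤ} {α β γ δ : ℝ}

theorem tripleProd_relation (x y : ℤ × ℤ × ℤ)
    (h : α • intPoint a + β • intPoint b = γ • intPoint c + δ • intPoint d) :
    α * tripleProd x y a + β * tripleProd x y b = γ * tripleProd x y c + δ * tripleProd x y d := by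
  have hcoord (i : Fin 3) := congrArg (fun p : Space3 => p i) h
  have h₀ := hcoord 0
  have h₁ := hcoord 1
  have h₂ := hcoord 2
  simp only [intPoint, PiLp.add_apply, PiLp.smul_apply, Matrix.cons_val, smul_eq_mul] at h₀ h₁ h₂
  simp only [tripleProd]
  push_cast
  linear_combination (crossProd x y).1 * h₀ + (crossProd x y).2.1 * h₁ + (crossProd x y).2.2 * h₂

theorem tripleProd_self_left (a b : ℤ × ℤ × ℤ) : tripleProd a b a = 0 := by
  simp only [tripleProd, crossProd]; ring

theorem tripleProd_self_right (a b : ℤ × ℤ × ℤ) : tripleProd a b b = 0 := by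
  simp only [tripleProd, crossProd]; ring

theorem tripleProd_rotate (a b c : ℤ × ℤ × ℤ) : tripleProd b c a = tripleProd a b c := by
  simp only [tripleProd, crossProd]; ring

theorem tripleProd_swap (a b c : ℤ × ℤ × ℤ) : tripleProd b a c = -tripleProd a b c := by
  simp only [tripleProd, crossProd]; ring

theorem tripleProd_swap_right (a b c : ℤ × ℤ × ℤ) : tripleProd a c b = -tripleProd a b c := by
  simp only [tripleProd, crossProd]; ring

theorem exists_tripleProd_ne_zero (h : crossProd a b ≠ 0) : ∃ x, tripleProd a b x ≠ 0 := by
  by_contra! hzero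
  refine h (Prod.ext ?_ (Prod.ext ?_ ?_))
  · simpa [tripleProd] using hzero (1, 0, 0)
  · simpa [tripleProd] using hzero (0, 1, 0)
  · simpa [tripleProd] using hzero (0, 0, 1)

theorem eq_of_crossProd_ne_zero (hab : crossProd a b ≠ 0)
    (h : α • intPoint a + β • intPoint b = γ • intPoint a + δ • intPoint b) : α = γ ∧ β = δ := by
  obtain ⟨x, hx⟩ := exists_tripleProd_ne_zero hab
  have hx' : (tripleProd a b x : ℝ) ≠ 0 := Int.cast_ne_zero.2 hx
  have hα := tripleProd_relation b x h
  have hβ := tripleProd_relation x a h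
  simp only [tripleProd_self_left, tripleProd_self_right, tripleProd_rotate a b x,
    ← tripleProd_rotate x a b, Int.cast_zero, mul_zero, add_zero, zero_add] at hα hβ
  exact ⟨mul_right_cancel₀ hx' hα, mul_right_cancel₀ hx' hβ⟩

theorem eq_of_tripleProd_ne_zero (habd : tripleProd a b d ≠ 0)
    (h : α • intPoint a + β • intPoint b = γ • intPoint a + δ • intPoint d) :
    α = γ ∧ β = 0 ∧ δ = 0 := by
  have habd' : (tripleProd a b d : ℝ) ≠ 0 := Int.cast_ne_zero.2 habd
  have hα := tripleProd_relation b d h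
  have hβ := tripleProd_relation d a h
  have hδ := tripleProd_relation a b h
  simp only [tripleProd_self_left, tripleProd_self_right, tripleProd_rotate a b d,
    ← tripleProd_rotate d a b, Int.cast_zero, mul_zero, add_zero, zero_add] at hα hβ hδ
  exact ⟨mul_right_cancel₀ habd' hα, (mul_eq_zero.1 hβ).resolve_right habd',
    (mul_eq_zero.1 hδ.symm).resolve_right habd'⟩

/-- The coefficients of the linear dependency between `a`, `b`, `-c` and `-d`, by Cramer's rule. -/
def coneDependency (a b c d : ℤ × ℤ × ℤ) : Fin 4 → ℤ :=
  ![tripleProd b c d, -tripleProd a c d, -tripleProd a b d, tripleProd a b c]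

theorem coneDependency_proportional
    (h : α • intPoint a + β • intPoint b = γ • intPoint c + δ • intPoint d) (i j : Fin 4) :
    ![α, β, γ, δ] i * coneDependency a b c d j = ![α, β, γ, δ] j * coneDependency a b c d i := by
  have hab := tripleProd_relation a b h
  have hac := tripleProd_relation a c h
  have had := tripleProd_relation a d h
  have hbc := tripleProd_relation b c h
  have hbd := tripleProd_relation b d h
  have hcd := tripleProd_relation c d h
  simp only [tripleProd_self_left, tripleProd_self_right, tripleProd_rotate a c d,
    tripleProd_rotate b c d, tripleProd_rotate a b c, tripleProd_rotate a b d,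
    tripleProd_swap_right a b c, tripleProd_swap_right a b d, tripleProd_swap_right a c d,
    tripleProd_swap_right b c d, Int.cast_neg, Int.cast_zero] at hab hac had hbc hbd hcd
  fin_cases i <;> fin_cases j <;>
    simp only [coneDependency, Fin.zero_eta, Fin.mk_one, Fin.reduceFinMk, Matrix.cons_val,
      Int.cast_neg] <;>
    linarith

theorem eq_zero_of_proportional {ι : Type*} {x y : ι → ℝ} (hx : ∀ i, 0 ≤ x i)
    (hxy : ∀ i j, x i * y j = x j * y i) (hneg : ∃ i, y i < 0) (hpos : ∃ i, 0 < y i) : x = 0 := by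
  obtain ⟨i, hi⟩ := hneg
  obtain ⟨j, hj⟩ := hpos
  have hxi : x i = 0 := by nlinarith [hxy i j, hx i, hx j]
  funext k
  simpa [hxi, hi.ne] using hxy k i

end TripleProduct

section Links

variable {V : Type*} [DecidableEq V]

/-- The cones spanned by the edges `e` and `f`, with vertices placed at `P` and apex at the origin,
meet only in the cone spanned by the common vertices of `e` and `f`. -/
def ConesMeetInFace {E : Type*} [AddCommMonoid E] [Module ℝ E] (P : V → E) (e f : V × V) : Prop :=
  ∀ α β γ δ : ℝ, 0 ≤ α → 0 ≤ β → 0 ≤ γ → 0 ≤ δ →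
    α • P e.1 + β • P e.2 = γ • P f.1 + δ • P f.2 →
    Pi.single e.1 α + Pi.single e.2 β = (Pi.single f.1 γ + Pi.single f.2 δ : V → ℝ)

theorem ConesMeetInFace.symm {E : Type*} [AddCommMonoid E] [Module ℝ E] {P : V → E} {e f : V × V}
    (h : ConesMeetInFace P e f) : ConesMeetInFace P f e :=
  fun γ δ α β hγ hδ hα hβ hrel => (h α β γ δ hα hβ hγ hδ hrel.symm).symm

/-- A sufficient condition for the cones over two different edges to meet in a common face. -/
def ConesSeparated (P : V → ℤ × ℤ × ℤ) (e f : V × V) : Prop :=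
  if e.1 = f.1 then tripleProd (P e.1) (P e.2) (P f.2) ≠ 0
  else if e.1 = f.2 then tripleProd (P e.1) (P e.2) (P f.1) ≠ 0
  else if e.2 = f.1 then tripleProd (P e.1) (P e.2) (P f.2) ≠ 0
  else if e.2 = f.2 then tripleProd (P e.1) (P e.2) (P f.1) ≠ 0
  else (∃ i, coneDependency (P e.1) (P e.2) (P f.1) (P f.2) i < 0) ∧
    ∃ i, 0 < coneDependency (P e.1) (P e.2) (P f.1) (P f.2) i

instance (P : V → ℤ × ℤ × ℤ) (e f : V × V) : Decidable (ConesSeparated P e f) := by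
  unfold ConesSeparated; infer_instance

theorem ConesSeparated.conesMeetInFace {P : V → ℤ × ℤ × ℤ} {e f : V × V}
    (h : ConesSeparated P e f) : ConesMeetInFace (intPoint ∘ P) e f := by
  obtain ⟨a, b⟩ := e
  obtain ⟨c, d⟩ := f
  intro α β γ δ hα hβ hγ hδ hrel
  simp only [ConesSeparated] at h
  simp only [Function.comp_apply] at hrel ⊢
  split_ifs at h with hac had hbc hbd
  · subst hac
    obtain ⟨rfl, rfl, rfl⟩ := eq_of_tripleProd_ne_zero h hrel
    simp
  · subst had
    rw [add_comm (γ • _)] at hrel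
    obtain ⟨rfl, rfl, rfl⟩ := eq_of_tripleProd_ne_zero h hrel
    simp
  · subst hbc
    rw [add_comm (α • _)] at hrel
    rw [← neg_ne_zero, ← tripleProd_swap] at h
    obtain ⟨rfl, rfl, rfl⟩ := eq_of_tripleProd_ne_zero h hrel
    simp
  · subst hbd
    rw [add_comm (α • _), add_comm (γ • _)] at hrel
    rw [← neg_ne_zero, ← tripleProd_swap] at h
    obtain ⟨rfl, rfl, rfl⟩ := eq_of_tripleProd_ne_zero h hrel
    simp
  · obtain ⟨⟨i, hi⟩, j, hj⟩ := h
    have hzero := eq_zero_of_proportional (x := ![α, β, γ, δ])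
      (fun k => by fin_cases k <;> assumption) (coneDependency_proportional hrel)
      ⟨i, Int.cast_lt_zero.2 hi⟩ ⟨j, Int.cast_pos.2 hj⟩
    simp only [Matrix.cons_eq_zero_iff] at hzero
    obtain ⟨rfl, rfl, rfl, rfl, -⟩ := hzero
    simp

theorem conesMeetInFace_self {P : V → ℤ × ℤ × ℤ} {e : V × V}
    (h : crossProd (P e.1) (P e.2) ≠ 0) : ConesMeetInFace (intPoint ∘ P) e e := by
  intro α β γ δ _ _ _ _ hrel
  obtain ⟨rfl, rfl⟩ := eq_of_crossProd_ne_zero h hrel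
  rfl

theorem eq_single_add_single {v : V} {x : V → ℝ} {e : V × V}
    (he : ({v, e.1, e.2} : Finset V).card = 3)
    (hx : Function.support x ⊆ ({v, e.1, e.2} : Finset V)) :
    x = Pi.single v (x v) + (Pi.single e.1 (x e.1) + Pi.single e.2 (x e.2)) := by
  have hve : v ∉ ({e.1, e.2} : Finset V) := fun hmem => by
    have := Finset.card_le_two (a := e.1) (b := e.2)
    rw [Finset.insert_eq_of_mem hmem] at he
    omega
  have hee : e.1 ≠ e.2 := fun heq => by
    rw [heq, Finset.pair_eq_singleton] at he
    have := Finset.card_le_two (a := v) (b := e.2)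
    omega
  rw [Finset.mem_insert, Finset.mem_singleton, not_or] at hve
  funext w
  by_cases hw : w ∈ ({v, e.1, e.2} : Finset V)
  · obtain rfl | rfl | rfl : w = v ∨ w = e.1 ∨ w = e.2 := by simpa using hw
    · simp [hve.1, hve.2]
    · simp [Ne.symm hve.1, hee]
    · simp [Ne.symm hve.2, hee.symm]
  · have hxw : x w = 0 := Function.notMem_support.1 fun hne => hw (hx hne)
    simp only [Finset.mem_insert, Finset.mem_singleton, not_or] at hw
    simp [hxw, hw.1, hw.2.1, hw.2.2]

end Links

section OpenStars

variable {V : Type} [Fintype V] [DecidableEq V] {T : Finset (Finset V)} {v : V} {ψ : V → Space3}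

theorem simplexwiseLinear_eq_of_sum_eq_one {x : V → ℝ} {e : V × V} {a α β : ℝ}
    (hx : x = Pi.single v a + (Pi.single e.1 α + Pi.single e.2 β)) (hsum : ∑ w, x w = 1) :
    simplexwiseLinear ψ x = ψ v + (α • (ψ e.1 - ψ v) + β • (ψ e.2 - ψ v)) := by
  have ha : a + (α + β) = 1 := by
    rw [← hsum, hx]
    simp [Finset.sum_add_distrib]
  rw [simplexwiseLinear, hx]
  simp only [Pi.add_apply, add_smul, Finset.sum_add_distrib, Pi.single_apply, ite_smul, zero_smul,
    Finset.sum_ite_eq', Finset.mem_univ, if_true]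
  rw [eq_sub_of_add_eq ha]
  module

theorem injOn_openStar_of_link {E : List (V × V)} (hcard : ∀ t ∈ T, t.card = 3)
    (hlink : ∀ t ∈ T, v ∈ t → ∃ e ∈ E, t = {v, e.1, e.2})
    (hcones : ∀ e ∈ E, ∀ f ∈ E, ConesMeetInFace (fun w => ψ w - ψ v) e f) :
    Set.InjOn (simplexwiseLinear ψ) (facetSpace T ∩ {x | x v ≠ 0}) := by
  have hform : ∀ x ∈ facetSpace T ∩ {x | x v ≠ 0}, ∃ e ∈ E,
      x = Pi.single v (x v) + (Pi.single e.1 (x e.1) + Pi.single e.2 (x e.2)) := by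
    rintro x ⟨⟨-, t, ht, hxt⟩, hxv⟩
    obtain ⟨e, he, rfl⟩ := hlink t ht (hxt hxv)
    exact ⟨e, he, eq_single_add_single (hcard _ ht) hxt⟩
  rintro x hx y hy hxy
  obtain ⟨e, he, hxe⟩ := hform x hx
  obtain ⟨f, hf, hyf⟩ := hform y hy
  have hsx := hx.1.1.2
  have hsy := hy.1.1.2
  rw [simplexwiseLinear_eq_of_sum_eq_one hxe hsx, simplexwiseLinear_eq_of_sum_eq_one hyf hsy,
    add_right_inj] at hxy
  have hlink := hcones e he f hf _ _ _ _ (hx.1.1.1 _) (hx.1.1.1 _) (hy.1.1.1 _) (hy.1.1.1 _) hxy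
  have hdiff : x - y = Pi.single v (x v - y v) := by
    rw [Pi.single_sub]
    linear_combination hxe - hyf + hlink
  have hv : x v - y v = 0 := by
    have hsum := congrArg (fun z : V → ℝ => ∑ w, z w) hdiff
    simpa [Finset.sum_sub_distrib, hsx, hsy] using hsum.symm
  rwa [hv, Pi.single_zero, sub_eq_zero] at hdiff

end OpenStars

section IntegralRealizations

variable {V : Type} [Fintype V] [DecidableEq V]

/-- The set of the three given vertices. It is a filter of all vertices, so that equal sets are
listed in the same order when they are compared by computation. -/
def triangle (t : V × V × V) : Finset V := {v | v = t.1 ∨ v = t.2.1 ∨ v = t.2.2}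

/-- The set of triangles occurring in a list. -/
def triangles (F : List (V × V × V)) : Finset (Finset V) := (F.map triangle).toFinset

/-- The edges opposite to `v` in the triangles of `F` that contain `v`. -/
def linkEdges (F : List (V × V × V)) (v : V) : List (V × V) :=
  F.filterMap fun t =>
    if t.1 = v then some t.2
    else if t.2.1 = v then some (t.1, t.2.2)
    else if t.2.2 = v then some (t.1, t.2.1)
    else none

theorem triangle_eq (t : V × V × V) : triangle t = {t.1, t.2.1, t.2.2} := by
  ext v
  simp [triangle]

theorem mem_triangles {F : List (V × V × V)} {s : Finset V} :
    s ∈ triangles F ↔ ∃ t ∈ F, triangle t = s := by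
  rw [triangles, List.mem_toFinset, List.mem_map]

theorem exists_mem_linkEdges {F : List (V × V × V)} {v : V} {s : Finset V} (hs : s ∈ triangles F)
    (hv : v ∈ s) : ∃ e ∈ linkEdges F v, s = {v, e.1, e.2} := by
  obtain ⟨⟨a, b, c⟩, ht, rfl⟩ := mem_triangles.1 hs
  have hmem {e : V × V} (he : (if a = v then some (b, c) else if b = v then some (a, c)
      else if c = v then some (a, b) else none) = some e) : e ∈ linkEdges F v :=
    List.mem_filterMap.2 ⟨_, ht, he⟩
  by_cases ha : a = v
  · exact ⟨(b, c), hmem (if_pos ha), by rw [← ha, triangle_eq]⟩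
  by_cases hb : b = v
  · exact ⟨(a, c), hmem (by rw [if_neg ha, if_pos hb]), by
      rw [← hb, triangle_eq, Finset.insert_comm]⟩
  obtain rfl : c = v := by
    simpa [triangle, Ne.symm ha, Ne.symm hb, eq_comm] using hv
  exact ⟨(a, b), hmem (by rw [if_neg ha, if_neg hb, if_pos rfl]), by
    rw [triangle_eq, Finset.pair_comm, Finset.insert_comm, Finset.pair_comm, Finset.insert_comm]⟩

/-- The rotation by the angle `π` about the third coordinate axis. -/
noncomputable def axisRotation : Space3 ≃ᵃⁱ[ℝ] Space3 :=
  (LinearIsometryEquiv.piLpCongrRight 2 fun i : Fin 3 =>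
    if i = 2 then LinearIsometryEquiv.refl ℝ ℝ else LinearIsometryEquiv.neg ℝ).toAffineIsometryEquiv

theorem axisRotation_apply (x : Space3) (i : Fin 3) :
    axisRotation x i = if i = 2 then x i else -x i := by
  change (if i = 2 then LinearIsometryEquiv.refl ℝ ℝ else LinearIsometryEquiv.neg ℝ) (x i) = _
  split_ifs <;> rfl

theorem isTwofoldRotation_axisRotation : IsTwofoldRotation axisRotation := by
  refine ⟨0, EuclideanSpace.single 2 1, by simp, fun x => ?_⟩
  ext i
  rw [axisRotation_apply]
  fin_cases i <;> simp [EuclideanSpace.inner_single_left]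

theorem exists_intPoint_eq (p : ℤ × ℤ × ℤ) (i : Fin 3) : ∃ n : ℤ, intPoint p i = n := by
  fin_cases i
  exacts [⟨p.1, rfl⟩, ⟨p.2.1, rfl⟩, ⟨p.2.2, rfl⟩]

theorem intPoint_axisRotation (p : ℤ × ℤ × ℤ) :
    intPoint (-p.1, -p.2.1, p.2.2) = axisRotation (intPoint p) := by
  ext i
  rw [axisRotation_apply]
  fin_cases i <;> simp [intPoint]

variable {F : List (V × V × V)} {P : V → ℤ × ℤ × ℤ} {σ : V → V}

theorem injOn_openStar_of_conesSeparated {v : V} (hcard : ∀ t ∈ triangles F, t.card = 3)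
    (hedge : ∀ e ∈ linkEdges F v, crossProd (P e.1 - P v) (P e.2 - P v) ≠ 0)
    (hcones : (linkEdges F v).Pairwise (ConesSeparated fun w => P w - P v)) :
    Set.InjOn (simplexwiseLinear (intPoint ∘ P)) (facetSpace (triangles F) ∩ {x | x v ≠ 0}) := by
  refine injOn_openStar_of_link hcard (fun t => exists_mem_linkEdges) ?_
  simp only [Function.comp_apply, ← intPoint_sub]
  have : Std.Symm (ConesMeetInFace (intPoint ∘ fun w => P w - P v)) := ⟨fun _ _ h => h.symm⟩
  intro e he f hf
  exact List.Pairwise.forall_of_forall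
    (fun e he => conesMeetInFace_self (hedge e he))
    (hcones.imp ConesSeparated.conesMeetInFace) he hf

theorem isPolyhedralImmersion_and_isGeometricSymmetry {S : Set V}
    {hT : ∀ v, ∃ t ∈ triangles F, v ∈ t} (hcard : ∀ t ∈ triangles F, t.card = 3)
    (hσ : Function.Involutive σ)
    (hF : ∀ t ∈ F, t.map σ (Prod.map σ σ) ∈ F)
    (hP : ∀ v, P (σ v) = (-(P v).1, -(P v).2.1, (P v).2.2))
    (hS : ∀ v, v ∈ S ∨ σ v ∈ S)
    (hedge : ∀ v ∈ S, ∀ e ∈ linkEdges F v, crossProd (P e.1 - P v) (P e.2 - P v) ≠ 0)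
    (hcones : ∀ v ∈ S, (linkEdges F v).Pairwise (ConesSeparated fun w => P w - P v)) :
    IsPolyhedralImmersion (facetComplex (triangles F) hT) (intPoint ∘ P) ∧
      IsGeometricSymmetry (facetComplex (triangles F) hT) (intPoint ∘ P) axisRotation := by
  have hiso : IsComplexIso (facetComplex _ hT) (facetComplex _ hT) (hσ.toPerm σ) :=
    isComplexIso_facetComplex hT fun s hs => by
      obtain ⟨t, ht, rfl⟩ := mem_triangles.1 hs
      exact mem_triangles.2 ⟨_, hF t ht, by simp [triangle_eq]⟩
  have hψ v : (intPoint ∘ P) (hσ.toPerm σ v) = axisRotation ((intPoint ∘ P) v) := by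
    rw [Function.comp_apply, Function.comp_apply, ← intPoint_axisRotation, ← hP]
    rfl
  have hinj v (hv : v ∈ S) : Set.InjOn (simplexwiseLinear (intPoint ∘ P))
      (geomRealization (facetComplex _ hT) ∩ {x | x v ≠ 0}) := by
    rw [geomRealization_facetComplex]
    exact injOn_openStar_of_conesSeparated hcard (hedge v hv) (hcones v hv)
  refine ⟨isPolyhedralImmersion_of_injOn_openStar fun v => ?_,
    isGeometricSymmetry_of_isComplexIso hiso hψ⟩
  exact (hS v).elim (hinj v) fun hv => injOn_openStar_of_isComplexIso hiso hψ (hinj _ hv)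

end IntegralRealizations

section Catalogue

/-- The triangle whose vertices are the three decimal digits of a number, with leading zeros. -/
def digitTriangle (t : ℕ) : Fin 10 × Fin 10 × Fin 10 :=
  (Fin.ofNat 10 (t / 100), Fin.ofNat 10 (t / 10), Fin.ofNat 10 t)

/-- The edge whose vertices are the two decimal digits of a number, with leading zeros. -/
def digitEdge (t : ℕ) : Finset (Fin 10) := {v | v = Fin.ofNat 10 (t / 10) ∨ v = Fin.ofNat 10 t}

/-- The facets of a triangulation of `N₄` with ten vertices. -/
def baseFacets : Finset (Finset (Fin 10)) :=
  triangles ([79, 89, 67, 129, 12, 459, 359, 346, 149, 34, 24, 369, 578, 689, 35, 457, 467, 56, 568,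
    279, 278, 18, 248, 148].map digitTriangle)

/-- The vertices of `baseFacets` among those of `surfaceFacets`. -/
def baseVertex : Fin 10 → Fin 22 := ![0, 13, 3, 2, 12, 8, 20, 6, 15, 9]

/-- The faces flipped in reducing `surfaceFacets` to ten vertices. -/
def reductionMoves : List (Finset (Fin 22)) :=
  [{3, 4}, {16, 17}, {9, 10}, {10, 11}, {0, 19}, {0, 13}, {2, 10}, {10}, {4, 15}, {4}, {1, 2},
   {6, 17}, {9, 21}, {0, 17}, {17}, {11, 21}, {0, 1}, {1}, {2, 21}, {14, 15}, {9, 16}, {6, 16},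
   {16}, {11, 20}, {9, 19}, {19, 20}, {19}, {11, 12}, {9, 11}, {11}, {3, 13}, {0, 14}, {14},
   {9, 15}, {0, 5}, {5, 6}, {5}, {0, 21}, {0, 18}, {20, 21}, {7, 21}, {7, 18}, {12, 21}, {21},
   {7, 8}, {7, 12}, {7}, {9, 18}, {18, 20}, {18}]

theorem movesTo_surfaceFacets :
    MovesTo reductionMoves surfaceFacets (baseFacets.image (Finset.image baseVertex)) := by
  decide +kernel

theorem nonempty_homeomorph_baseFacets :
    Nonempty (facetSpace baseFacets ≃ₜ NonorientableSurface 4) := by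
  have hinj : Function.Injective baseVertex := by decide
  obtain ⟨f⟩ := nonempty_facetSpace_homeomorph_image hinj baseFacets
  obtain ⟨g⟩ := movesTo_surfaceFacets.nonempty_homeomorph
  obtain ⟨h⟩ := nonempty_homeomorph_surfaceFacets
  exact ⟨f.trans (h.trans g).symm⟩

/-- A triangulation with vertex set `Fin 10` and an involutive automorphism `symmetry`, together
with a sequence of edge flips that produces it from `baseFacets` and the coordinates of the vertices
in a symmetric realization. Triangles and edges are encoded as by `digitTriangle` and `digitEdge`;
of each orbit of triangles, only one is listed in `facets`. -/
structure RealizedTriangulation where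
  facets : List ℕ
  flips : List ℕ
  symmetry : List ℕ
  coords : List (ℤ × ℤ × ℤ)

namespace RealizedTriangulation

variable (r : RealizedTriangulation)

/-- The automorphism, as a map of the vertices. -/
def vertexMap (v : Fin 10) : Fin 10 := Fin.ofNat 10 (r.symmetry.getD v 0)

/-- The list of all triangles. -/
def triangleList : List (Fin 10 × Fin 10 × Fin 10) :=
  r.facets.map digitTriangle ++
    (r.facets.map digitTriangle).map (Prod.map r.vertexMap (Prod.map r.vertexMap r.vertexMap))

/-- The position of a vertex. -/
def position (v : Fin 10) : ℤ × ℤ × ℤ := r.coords.getD v 0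

end RealizedTriangulation

/-- The realized triangulations, the axis of rotation being the third coordinate axis. -/
def realizedTriangulations : List RealizedTriangulation :=
  [⟨[12, 16, 28, 34, 35, 48, 56, 129, 148, 149, 238, 359], [69, 78, 9, 8, 7, 24, 58, 68], [7, 6, 4,
    9, 2, 8, 1, 0, 5, 3], [(-12, 7, -3), (-3, 15, 12), (-2, 15, 5), (16, 1, -11), (2, -15, 5), (-9,
    -6, -10), (3, -15, 12), (12, -7, -3), (9, 6, -10), (-16, -1, -11)]⟩,
   ⟨[12, 18, 25, 45, 129, 136, 138, 146, 149, 235, 238, 456], [4, 3, 24, 48, 34, 59, 45, 67, 6, 89],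
    [0, 7, 9, 3, 8, 6, 5, 1, 4, 2], [(0, 0, 9), (-10, -14, -7), (-13, -15, -15), (0, 0, -1), (0, 1,
    -2), (-3, -4, 3), (3, 4, 3), (10, 14, -7), (0, -1, -2), (13, 15, -15)]⟩,
   ⟨[12, 17, 28, 35, 38, 46, 47, 56, 134, 178, 256, 268], [78, 9, 8, 24, 4, 48, 58, 67], [9, 3, 5,
    1, 8, 2, 7, 6, 4, 0], [(-2, -3, -6), (-2, 15, 4), (6, -7, -12), (2, -15, 4), (8, 15, -11), (-6,
    7, -12), (-1, -2, -11), (1, 2, -11), (-8, -15, -11), (2, 3, -6)]⟩,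
   ⟨[12, 18, 26, 36, 37, 79, 135, 147, 148, 157, 345, 347], [46, 49, 45, 3, 5, 4, 59, 67, 78], [9,
    2, 1, 6, 5, 4, 3, 8, 7, 0], [(-24, 15, -12), (-25, -12, 25), (25, 12, 25), (6, -3, 5), (-14, -6,
    17), (14, 6, 17), (-6, 3, 5), (23, 28, -30), (-23, -28, -30), (24, -15, -12)]⟩,
   ⟨[12, 14, 23, 35, 49, 56, 67, 146, 157, 167, 346, 368], [4, 18, 49, 8, 45, 47, 69], [9, 2, 1, 5,
    7, 3, 8, 4, 6, 0], [(-2, 6, 13), (-12, -12, 14), (12, 12, 14), (15, -1, -5), (-15, -4, 11),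
    (-15, 1, -5), (-9, -3, 11), (15, 4, 11), (9, 3, 11), (2, -6, 13)]⟩,
   ⟨[13, 14, 35, 49, 56, 67, 123, 146, 157, 167, 346, 368], [4, 2, 18, 49, 8, 19, 45, 47, 69], [9,
    2, 1, 5, 7, 3, 8, 4, 6, 0], [(1, -3, -1), (11, -4, 4), (-11, 4, 4), (1, 5, 2), (-9, 11, -3),
    (-1, -5, 2), (-9, 9, -7), (9, -11, -3), (9, -9, -7), (-1, 3, -1)]⟩,
   ⟨[12, 16, 28, 34, 35, 48, 129, 148, 167, 178, 268, 367], [46, 69, 78, 9, 8, 7, 24, 58], [5, 9, 4,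
    6, 2, 0, 3, 8, 7, 1], [(-5, 3, -5), (-8, 11, -1), (11, -7, -4), (7, -7, -11), (-11, 7, -4), (5,
    -3, -5), (-7, 7, -11), (-1, 12, 1), (1, -12, 1), (8, -11, -1)]⟩,
   ⟨[12, 14, 23, 35, 47, 56, 67, 146, 157, 167, 346, 368], [4, 18, 49, 8, 45, 47, 9, 69], [9, 2, 1,
    5, 7, 3, 8, 4, 6, 0], [(9, 4, 0), (-11, 4, -11), (11, -4, -11), (-3, -2, -4), (2, 7, 12), (3, 2,
    -4), (1, 1, 5), (-2, -7, 12), (-1, -1, 5), (-9, -4, 0)]⟩,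
   ⟨[12, 17, 23, 35, 46, 47, 56, 145, 148, 178, 267, 268], [4, 24, 49, 67, 58, 78, 9, 8], [9, 3, 5,
    1, 8, 2, 7, 6, 4, 0], [(2, 4, 12), (-13, 3, -10), (22, -19, 24), (13, -3, -10), (-30, -29, -1),
    (-22, 19, 24), (8, -5, 26), (-8, 5, 26), (30, 29, -1), (-2, -4, 12)]⟩,
   ⟨[12, 15, 27, 35, 38, 79, 89, 123, 138, 148, 157, 179], [4, 2, 1, 29, 78, 27, 58, 56, 6, 25, 39],
    [6, 4, 7, 5, 1, 3, 0, 2, 9, 8], [(-4, 2, 14), (-4, 12, 3), (-4, 5, 9), (-10, 15, 13), (4, -12,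
    3), (10, -15, 13), (4, -2, 14), (4, -5, 9), (10, 6, 15), (-10, -6, 15)]⟩,
   ⟨[12, 17, 23, 46, 47, 56, 129, 145, 148, 178, 248, 268], [4, 49, 67, 58, 69, 78, 9, 8, 27], [3,
    9, 5, 0, 6, 2, 4, 8, 7, 1], [(-12, -2, -12), (-5, 2, 4), (7, 12, 0), (12, 2, -12), (12, 4, -8),
    (-7, -12, 0), (-12, -4, -8), (-8, -3, -7), (8, 3, -7), (5, -2, 4)]⟩,
   ⟨[12, 17, 28, 38, 124, 136, 138, 146, 178, 249, 279, 349], [78, 9, 8, 24, 4, 19, 48, 34, 59, 67],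
    [0, 5, 6, 7, 8, 1, 2, 3, 4, 9], [(0, 0, 5), (-30, 0, 17), (6, 2, 10), (-6, -6, 1), (-27, -26,
    -1), (30, 0, 17), (-6, -2, 10), (6, 6, 1), (27, 26, -1), (0, 0, 3)]⟩,
   ⟨[12, 18, 23, 35, 56, 67, 78, 127, 238, 256, 257, 268], [4, 24, 29, 78, 9, 58], [9, 1, 4, 5, 2,
    3, 6, 8, 7, 0], [(10, -9, 11), (0, 0, 11), (1, 13, 10), (-15, -3, 15), (-1, -13, 10), (15, 3,
    15), (0, 0, -4), (-2, -4, 5), (2, 4, 5), (-10, 9, 11)]⟩,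
   ⟨[13, 18, 27, 35, 56, 67, 123, 146, 167, 179, 346, 359], [4, 2, 78, 79, 45, 28, 9, 49, 47], [8,
    2, 1, 9, 7, 6, 5, 4, 0, 3], [(3, -6, 12), (11, -2, -7), (-11, 2, -7), (4, -12, -3), (3, -12,
    -2), (2, -5, 0), (-2, 5, 0), (-3, 12, -2), (-3, 6, 12), (-4, 12, -3)]⟩,
   ⟨[12, 17, 23, 124, 136, 138, 146, 178, 238, 249, 279, 349], [4, 24, 19, 48, 34, 59, 78, 9, 8],
    [0, 5, 6, 7, 8, 1, 2, 3, 4, 9], [(0, 0, 1), (3, -11, -10), (7, 10, 12), (9, -7, -9), (-11, -11,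
    -9), (-3, 11, -10), (-7, -10, 12), (-9, 7, -9), (11, 11, -9), (0, 0, -5)]⟩,
   ⟨[12, 18, 23, 35, 56, 67, 78, 127, 136, 146, 257, 258], [4, 24, 29, 48, 34, 59, 68, 78, 9], [9,
    3, 4, 1, 2, 7, 8, 5, 6, 0], [(-2, 2, -10), (-4, -4, -4), (15, -6, -12), (4, 4, -4), (-15, 6,
    -12), (2, 0, -15), (-9, -10, -3), (-2, 0, -15), (9, 10, -3), (2, -2, -10)]⟩,
   ⟨[12, 15, 26, 35, 38, 79, 89, 123, 138, 148, 157, 179], [4, 2, 1, 29, 78, 27, 58, 56, 25, 39],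
    [6, 4, 7, 5, 1, 3, 0, 2, 9, 8], [(-2, -6, 2), (-1, -13, -12), (3, 12, 0), (1, 8, -8), (1, 13,
    -12), (-1, -8, -8), (2, 6, 2), (-3, -12, 0), (-11, -1, 4), (11, 1, 4)]⟩,
   ⟨[12, 17, 28, 35, 38, 46, 47, 56, 124, 134, 138, 346], [4, 24, 19, 8, 9, 23, 48, 67], [9, 7, 2,
    5, 8, 3, 6, 1, 4, 0], [(10, -2, 3), (5, -12, -12), (0, 0, -3), (-10, 9, 1), (-3, 9, -6), (10,
    -9, 1), (0, 0, 12), (-5, 12, -12), (3, -9, -6), (-10, 2, 3)]⟩,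
   ⟨[12, 18, 24, 47, 79, 89, 127, 134, 149, 179, 278, 457], [4, 3, 5, 24, 29, 48, 67, 6], [6, 3, 9,
    1, 8, 7, 0, 5, 4, 2], [(4, 0, 9), (15, -15, 12), (8, 12, 8), (-15, 15, 12), (-14, -9, 10), (2,
    -15, -8), (-4, 0, 9), (-2, 15, -8), (14, 9, 10), (-8, -12, 8)]⟩,
   ⟨[13, 14, 35, 47, 56, 67, 123, 146, 157, 167, 346, 368], [4, 2, 18, 49, 8, 19, 45, 47, 9, 69],
    [9, 2, 1, 5, 7, 3, 8, 4, 6, 0], [(-1, -1, -3), (-8, 12, 9), (8, -12, 9), (6, 12, 7), (3, -2,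
    -5), (-6, -12, 7), (12, -5, -12), (-3, 2, -5), (-12, 5, -12), (1, 1, -3)]⟩,
   ⟨[12, 18, 23, 35, 56, 67, 78, 125, 138, 238, 256, 268], [4, 24, 29, 48, 78, 9, 27, 58], [9, 1, 4,
    5, 2, 3, 6, 8, 7, 0], [(4, 15, -7), (0, 0, -2), (7, -16, -5), (-27, 30, -14), (-7, 16, -5), (27,
    -30, -14), (0, 0, 29), (-5, 2, 11), (5, -2, 11), (-4, -15, -7)]⟩,
   ⟨[12, 18, 25, 45, 127, 136, 138, 146, 149, 235, 238, 456], [4, 3, 24, 29, 48, 34, 59, 45, 67, 6,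
    89], [0, 7, 9, 3, 8, 6, 5, 1, 4, 2], [(0, 0, 9), (7, 12, 4), (0, 5, 1), (0, 0, -3), (-9, 0, -4),
    (-9, 11, -12), (9, -11, -12), (-7, -12, 4), (9, 0, -4), (0, -5, 1)]⟩,
   ⟨[12, 17, 28, 34, 35, 48, 56, 129, 148, 149, 238, 359], [69, 78, 9, 8, 24, 58, 68], [7, 6, 4, 9,
    2, 8, 1, 0, 5, 3], [(41, 44, -17), (-43, 45, -45), (40, 37, 14), (21, 25, 30), (-40, -37, 14),
    (-42, -4, -4), (43, -45, -45), (-41, -44, -17), (42, 4, -4), (-21, -25, 30)]⟩,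
   ⟨[12, 17, 28, 35, 38, 46, 47, 56, 134, 178, 267, 268], [4, 24, 48, 67, 58, 78, 9, 8, 23], [9, 3,
    5, 1, 8, 2, 7, 6, 4, 0], [(0, -6, -1), (-10, 0, 12), (12, 12, -8), (10, 0, 12), (-1, 11, -2),
    (-12, -12, -8), (2, -3, -6), (-2, 3, -6), (1, -11, -2), (0, 6, -1)]⟩,
   ⟨[12, 18, 24, 36, 37, 46, 79, 147, 148, 157, 345, 347], [46, 49, 45, 3, 5, 67, 78], [9, 2, 1, 6,
    5, 4, 3, 8, 7, 0], [(-9, -6, -30), (-20, -12, -14), (20, 12, -14), (-30, -21, -29), (-4, -14,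
    26), (4, 14, 26), (30, 21, -29), (15, -16, -20), (-15, 16, -20), (9, 6, -30)]⟩,
   ⟨[12, 16, 28, 34, 35, 48, 124, 148, 167, 178, 268, 367], [46, 69, 78, 9, 8, 7, 24, 19, 58], [5,
    9, 4, 6, 2, 0, 3, 8, 7, 1], [(2, 5, -2), (-11, -12, -4), (8, -1, -7), (5, 5, 1), (-8, 1, -7),
    (-2, -5, -2), (-5, -5, 1), (-3, -12, 8), (3, 12, 8), (11, 12, -4)]⟩,
   ⟨[13, 18, 35, 45, 47, 79, 123, 147, 148, 156, 167, 346], [4, 2, 49, 19, 45, 67, 6, 58, 57, 78],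
    [9, 2, 1, 5, 6, 3, 4, 8, 7, 0], [(2, -3, -6), (3, 13, -15), (-3, -13, -15), (-8, 13, -13), (-15,
    -12, 8), (8, -13, -13), (15, 12, 8), (11, 9, 0), (-11, -9, 0), (-2, 3, -6)]⟩,
   ⟨[12, 18, 26, 36, 37, 78, 135, 147, 148, 157, 345, 347], [46, 49, 45, 3, 5, 4, 59, 67, 78, 9],
    [9, 2, 1, 6, 5, 4, 3, 8, 7, 0], [(-30, 6, 5), (30, 30, -30), (-30, -30, -30), (8, -1, 8), (-12,
    1, 11), (12, -1, 11), (-8, 1, 8), (8, -11, 29), (-8, 11, 29), (30, -6, 5)]⟩,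
   ⟨[14, 19, 23, 35, 47, 56, 67, 146, 157, 167, 346, 368], [4, 18, 49, 8, 45, 47, 9, 12, 69], [9, 2,
    1, 5, 7, 3, 8, 4, 6, 0], [(-1, -12, -15), (-4, 3, -10), (4, -3, -10), (1, 3, -13), (-7, -5, 3),
    (-1, -3, -13), (-1, -2, -4), (7, 5, 3), (1, 2, -4), (1, 12, -15)]⟩,
   ⟨[13, 14, 35, 48, 56, 67, 79, 128, 138, 256, 257, 268], [4, 2, 18, 24, 23, 49, 45, 78, 58], [9,
    1, 4, 5, 2, 3, 6, 8, 7, 0], [(-13, 15, 14), (0, 0, 2), (-7, 3, 3), (0, 2, -3), (7, -3, 3), (0,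
    -2, -3), (0, 0, -8), (1, 15, 15), (-1, -15, 15), (13, -15, 14)]⟩,
   ⟨[12, 17, 23, 35, 46, 47, 56, 158, 178, 248, 267, 268], [4, 49, 67, 58, 14, 78, 9, 8], [9, 3, 5,
    1, 8, 2, 7, 6, 4, 0], [(-6, 0, 2), (3, 8, 5), (8, -8, 4), (-3, -8, 5), (9, 15, -10), (-8, 8, 4),
    (-4, -11, 6), (4, 11, 6), (-9, -15, -10), (6, 0, 2)]⟩,
   ⟨[15, 18, 27, 29, 38, 56, 67, 129, 148, 149, 248, 278], [4, 2, 3, 69, 79, 45, 47, 89], [3, 5, 6,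
    0, 7, 1, 2, 4, 9, 8], [(7, 13, 12), (12, 7, -9), (5, 6, 4), (-7, -13, 12), (8, 9, -15), (-12,
    -7, -9), (-5, -6, 4), (-8, -9, -15), (-8, 12, 6), (8, -12, 6)]⟩,
   ⟨[12, 14, 23, 35, 47, 58, 67, 68, 146, 157, 167, 346], [4, 18, 49, 8, 45, 47, 9, 56], [9, 2, 1,
    5, 7, 3, 8, 4, 6, 0], [(-8, 9, 11), (-4, -10, 10), (4, 10, 10), (-3, 5, 9), (-10, -3, 4), (3,
    -5, 9), (-3, 0, 6), (10, 3, 4), (3, 0, 6), (8, -9, 11)]⟩,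
   ⟨[12, 23, 35, 56, 67, 236, 246, 248, 258, 259, 349, 369], [4, 34, 59, 45, 78, 9, 8, 27], [1, 0,
    7, 8, 5, 4, 9, 2, 3, 6], [(12, 11, -8), (-12, -11, -8), (-23, 24, 30), (-28, 10, -1), (23, -5,
    9), (-23, 5, 9), (30, 20, -30), (23, -24, 30), (28, -10, -1), (-30, -20, -30)]⟩,
   ⟨[12, 17, 28, 46, 47, 56, 58, 124, 134, 178, 256, 268], [78, 9, 8, 24, 4, 19, 48, 58, 3, 67], [9,
    3, 5, 1, 8, 2, 7, 6, 4, 0], [(13, 15, -15), (-1, 12, 3), (-11, -2, -14), (1, -12, 3), (15, 10,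
    -15), (11, 2, -14), (-7, 2, 15), (7, -2, 15), (-15, -10, -15), (-13, -15, -15)]⟩,
   ⟨[12, 17, 28, 34, 35, 48, 56, 129, 145, 148, 159, 359], [49, 69, 78, 9, 8, 24, 58], [7, 6, 4, 9,
    2, 8, 1, 0, 5, 3], [(-3, 5, 5), (-14, 13, 15), (-1, -5, -5), (8, -4, 4), (1, 5, -5), (14, 1,
    -10), (14, -13, 15), (3, -5, 5), (-14, -1, -10), (-8, 4, 4)]⟩,
   ⟨[12, 16, 28, 34, 35, 48, 129, 148, 168, 236, 238, 378], [69, 78, 9, 58, 68, 7, 8, 24, 89], [5,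
    9, 4, 6, 2, 0, 3, 8, 7, 1], [(-1, 4, 12), (1, -2, 3), (1, -12, 4), (-11, 2, -4), (-1, 12, 4),
    (1, -4, 12), (11, -2, -4), (3, 1, -2), (-3, -1, -2), (-1, 2, 3)]⟩,
   ⟨[14, 17, 23, 24, 35, 56, 67, 127, 134, 138, 238, 257], [4, 24, 19, 8, 9, 12, 48, 78, 79], [9, 6,
    5, 4, 3, 2, 1, 8, 7, 0], [(8, 3, 6), (1, 0, 19), (11, 1, -12), (6, -8, 28), (-6, 8, 28), (-11,
    -1, -12), (-1, 0, 19), (-21, -7, -5), (21, 7, -5), (-8, -3, 6)]⟩,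
   ⟨[12, 17, 28, 34, 35, 48, 56, 129, 135, 139, 145, 148], [49, 59, 78, 9, 8, 24, 58], [7, 6, 4, 9,
    2, 8, 1, 0, 5, 3], [(15, -15, -10), (-3, -15, -2), (-10, 7, -4), (13, -15, -4), (10, -7, -4),
    (15, -10, 8), (3, 15, -2), (-15, 15, -10), (-15, 10, 8), (-13, 15, -4)]⟩,
   ⟨[13, 18, 35, 46, 47, 56, 79, 123, 129, 146, 236, 367], [4, 2, 34, 67, 58, 69, 39, 68, 24, 48],
    [8, 9, 4, 5, 2, 3, 7, 6, 0, 1], [(-6, -8, -9), (0, -5, 9), (12, -15, 2), (-13, -15, -14), (-12,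
    15, 2), (13, 15, -14), (15, 13, -15), (-15, -13, -15), (6, 8, -9), (0, 5, 9)]⟩,
   ⟨[12, 17, 23, 46, 47, 56, 125, 145, 148, 178, 248, 268], [4, 49, 19, 67, 58, 69, 78, 9, 8, 27],
    [3, 9, 5, 0, 6, 2, 4, 8, 7, 1], [(-10, 1, -3), (2, -7, -14), (-1, 0, -5), (10, -1, -3), (9, -11,
    5), (1, 0, -5), (-9, 11, 5), (3, -9, -13), (-3, 9, -13), (-2, 7, -14)]⟩,
   ⟨[12, 18, 23, 35, 56, 67, 78, 135, 145, 148, 234, 248], [4, 49, 36, 59, 78, 9], [9, 7, 8, 6, 5,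
    4, 3, 1, 2, 0], [(-1, 0, 3), (0, 1, -7), (-5, -11, 12), (1, 2, 7), (-12, 11, -12), (12, -11,
    -12), (-1, -2, 7), (0, -1, -7), (5, 11, 12), (1, 0, 3)]⟩,
   ⟨[12, 14, 23, 39, 47, 56, 67, 146, 157, 167, 346, 368], [4, 18, 49, 8, 45, 47, 9, 35, 69], [9, 2,
    1, 5, 7, 3, 8, 4, 6, 0], [(-12, -10, 11), (2, -4, -7), (-2, 4, -7), (-12, 3, 12), (-5, 10, -11),
    (12, -3, 12), (11, -9, 0), (5, -10, -11), (-11, 9, 0), (12, 10, 11)]⟩,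
   ⟨[12, 15, 26, 58, 79, 89, 123, 138, 148, 157, 179, 358], [4, 2, 1, 29, 78, 27, 58, 3, 56, 25],
    [6, 4, 7, 5, 1, 3, 0, 2, 9, 8], [(4, 1, 5), (15, -14, -8), (-12, 3, 3), (-1, 0, 1), (-15, 14,
    -8), (1, 0, 1), (-4, -1, 5), (12, -3, 3), (3, 15, 9), (-3, -15, 9)]⟩,
   ⟨[17, 18, 23, 27, 35, 56, 69, 123, 128, 134, 258, 368], [4, 29, 69, 7, 12, 48, 24, 78], [9, 7, 4,
    5, 2, 3, 8, 1, 6, 0], [(-5, -4, 11), (0, -1, -1), (6, 14, -9), (8, -1, 8), (-6, -14, -9), (-8,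
    1, 8), (15, -3, 10), (0, 1, -1), (-15, 3, 10), (5, 4, 11)]⟩,
   ⟨[12, 14, 23, 35, 48, 56, 69, 146, 157, 167, 346, 368], [4, 18, 49, 45, 47, 69, 7], [9, 2, 1, 5,
    7, 3, 8, 4, 6, 0], [(1, 13, 13), (-2, 2, -10), (2, -2, -10), (4, -1, 8), (5, -5, -15), (-4, 1,
    8), (-14, 6, 6), (-5, 5, -15), (14, -6, 6), (-1, -13, 13)]⟩,
   ⟨[15, 17, 25, 28, 67, 123, 124, 135, 148, 178, 238, 257], [4, 2, 3, 24, 19, 78, 9, 8, 56, 58],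
    [6, 9, 4, 5, 2, 3, 0, 8, 7, 1], [(1, -1, 6), (10, -10, -12), (-9, 2, -6), (4, 2, 1), (9, -2,
    -6), (-4, -2, 1), (-1, 1, 6), (-11, -12, -10), (11, 12, -10), (-10, 10, -12)]⟩,
   ⟨[15, 17, 25, 28, 67, 123, 129, 135, 148, 178, 238, 257], [4, 2, 3, 24, 78, 9, 8, 56, 58], [6, 9,
    4, 5, 2, 3, 0, 8, 7, 1], [(-1, 2, 6), (-11, -15, 12), (-7, 13, 10), (-12, 1, 9), (7, -13, 10),
    (12, -1, 9), (1, -2, 6), (-11, 15, -2), (11, -15, -2), (11, 15, 12)]⟩,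
   ⟨[12, 18, 24, 36, 37, 46, 78, 147, 148, 157, 345, 347], [46, 49, 45, 3, 5, 67, 78, 9], [9, 2, 1,
    6, 5, 4, 3, 8, 7, 0], [(-14, 13, 27), (-16, 12, 7), (16, -12, 7), (-30, 30, 25), (-2, 17, -22),
    (2, -17, -22), (30, -30, 25), (25, 28, 29), (-25, -28, 29), (14, -13, 27)]⟩,
   ⟨[12, 18, 24, 34, 39, 67, 78, 147, 148, 157, 346, 358], [49, 45, 69, 78, 9, 35, 5, 68], [9, 2, 1,
    6, 5, 4, 3, 8, 7, 0], [(-12, 25, -1), (26, 13, 20), (-26, -13, 20), (-6, 13, 4), (21, 11, 18),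
    (-21, -11, 18), (6, -13, 4), (-15, 18, -2), (15, -18, -2), (12, -25, -1)]⟩,
   ⟨[12, 18, 23, 35, 56, 67, 78, 135, 147, 148, 234, 248], [4, 49, 36, 45, 59, 78, 9], [9, 7, 8, 6,
    5, 4, 3, 1, 2, 0], [(0, 1, 6), (-9, -12, 2), (10, 9, 15), (5, 7, 4), (-14, 13, 9), (14, -13, 9),
    (-5, -7, 4), (9, 12, 2), (-10, -9, 15), (0, -1, 6)]⟩,
   ⟨[12, 18, 24, 36, 38, 46, 147, 148, 157, 345, 347, 378], [46, 49, 45, 3, 5, 67, 78, 9, 7, 89],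
    [9, 2, 1, 6, 5, 4, 3, 8, 7, 0], [(21, -5, 3), (-19, -2, -1), (19, 2, -1), (-30, 13, -12), (-30,
    -15, 27), (30, 15, 27), (30, -13, -12), (15, -23, -18), (-15, 23, -18), (-21, 5, 3)]⟩,
   ⟨[12, 19, 23, 35, 58, 67, 68, 124, 136, 138, 146, 238], [4, 24, 19, 8, 48, 34, 56, 47, 29], [9,
    7, 4, 5, 2, 3, 8, 1, 6, 0], [(-5, -6, -8), (1, -13, -7), (-1, 1, 15), (3, -6, 7), (1, -1, 15),
    (-3, 6, 7), (-9, 12, 1), (-1, 13, -7), (9, -12, 1), (5, 6, -8)]⟩,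
   ⟨[12, 17, 28, 38, 124, 138, 139, 146, 169, 178, 249, 349], [78, 9, 8, 24, 4, 19, 48, 34, 36, 59,
    27, 67], [0, 5, 6, 7, 8, 1, 2, 3, 4, 9], [(0, 0, -6), (-7, -8, 15), (0, 1, 4), (6, 0, -8), (13,
    -2, -15), (7, 8, 15), (0, -1, 4), (-6, 0, -8), (-13, 2, -15), (0, 0, 0)]⟩,
   ⟨[12, 18, 23, 35, 46, 47, 56, 78, 127, 238, 267, 368], [4, 24, 29, 67, 58, 78, 9, 68, 34], [9, 1,
    4, 5, 2, 3, 6, 8, 7, 0], [(-6, -2, -6), (0, 0, -15), (-6, 13, 3), (0, 6, 15), (6, -13, 3), (0,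
    -6, 15), (0, 0, 3), (-2, 15, -1), (2, -15, -1), (6, 2, -6)]⟩,
   ⟨[12, 18, 25, 46, 47, 56, 79, 127, 235, 238, 267, 368], [4, 3, 24, 29, 67, 58, 78, 68, 34, 59],
    [9, 1, 4, 5, 2, 3, 6, 8, 7, 0], [(1, 1, -2), (0, 0, -3), (6, -2, 5), (6, -12, 8), (-6, 2, 5),
    (-6, 12, 8), (0, 0, 2), (3, -5, 3), (-3, 5, 3), (-1, -1, -2)]⟩,
   ⟨[12, 18, 25, 46, 47, 56, 79, 127, 236, 258, 267, 358], [4, 3, 24, 29, 67, 58, 23, 78, 68, 69],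
    [9, 1, 4, 6, 2, 5, 3, 8, 7, 0], [(18, -32, 21), (0, 0, -26), (-24, -30, 26), (27, -13, 31), (24,
    30, 26), (0, 0, 26), (-27, 13, 31), (-20, 21, 20), (20, -21, 20), (-18, 32, 21)]⟩,
   ⟨[13, 14, 35, 48, 56, 67, 79, 123, 238, 256, 257, 268], [4, 2, 18, 24, 49, 78, 58], [9, 1, 4, 5,
    2, 3, 6, 8, 7, 0], [(-9, -5, -10), (0, 0, -8), (-12, -2, -9), (9, -2, -5), (12, 2, -9), (-9, 2,
    -5), (0, 0, 15), (15, -14, -13), (-15, 14, -13), (9, 5, -10)]⟩,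
   ⟨[12, 17, 28, 35, 38, 46, 47, 56, 148, 178, 267, 268], [4, 24, 67, 58, 78, 9, 8, 23], [9, 3, 5,
    1, 8, 2, 7, 6, 4, 0], [(-3, -2, 1), (5, -2, 7), (13, 11, 3), (-5, 2, 7), (13, -3, 8), (-13, -11,
    3), (4, 14, -9), (-4, -14, -9), (-13, 3, 8), (3, 2, 1)]⟩,
   ⟨[12, 17, 28, 34, 35, 48, 67, 129, 148, 178, 236, 238], [69, 78, 9, 8, 24, 58, 39, 68], [5, 9, 4,
    6, 2, 0, 3, 8, 7, 1], [(-5, 3, -4), (-12, 4, -14), (-14, -3, 11), (-15, -11, 15), (14, 3, 11),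
    (5, -3, -4), (15, 11, 15), (15, -6, -10), (-15, 6, -10), (12, -4, -14)]⟩,
   ⟨[12, 18, 25, 45, 127, 136, 138, 146, 149, 235, 238, 458], [4, 3, 24, 29, 48, 34, 59, 45, 67, 6,
    56, 89], [0, 7, 9, 3, 8, 6, 5, 1, 4, 2], [(0, 0, -12), (3, 11, 12), (6, 1, 11), (0, 0, -1), (5,
    -12, -2), (2, -2, -4), (-2, 2, -4), (-3, -11, 12), (-5, 12, -2), (-6, -1, 11)]⟩,
   ⟨[12, 18, 24, 34, 35, 67, 78, 126, 148, 179, 236, 289], [29, 46, 78, 9, 27, 58, 25, 68, 69, 39],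
    [5, 4, 7, 6, 1, 0, 3, 2, 9, 8], [(10, 8, -4), (1, 7, 10), (1, 6, 2), (-2, -7, -2), (-1, -7, 10),
    (-10, -8, -4), (2, 7, -2), (-1, -6, 2), (-4, 8, 3), (4, -8, 3)]⟩,
   ⟨[12, 18, 23, 35, 56, 67, 79, 127, 238, 257, 258, 367], [4, 24, 29, 46, 78], [9, 1, 4, 5, 2, 3,
    6, 8, 7, 0], [(12, 14, 12), (0, 0, -10), (4, -1, -9), (-10, 1, -7), (-4, 1, -9), (10, -1, -7),
    (0, 0, 9), (-15, 3, -15), (15, -3, -15), (-12, -14, 12)]⟩,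
   ⟨[13, 14, 24, 29, 35, 56, 67, 123, 128, 157, 158, 368], [4, 2, 18, 29, 27, 48, 8, 69, 78], [9, 4,
    7, 5, 1, 3, 8, 2, 6, 0], [(9, -15, 12), (13, -13, 13), (-1, -8, 9), (14, -3, -5), (-13, 13, 13),
    (-14, 3, -5), (-4, 6, 10), (1, 8, 9), (4, -6, 10), (-9, 15, 12)]⟩,
   ⟨[12, 14, 23, 35, 49, 58, 67, 68, 146, 157, 167, 346], [4, 18, 49, 8, 45, 47, 56], [9, 2, 1, 5,
    7, 3, 8, 4, 6, 0], [(11, 3, -12), (3, 11, 10), (-3, -11, 10), (0, 1, -3), (-2, 7, -5), (0, -1,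
    -3), (7, 1, -11), (2, -7, -5), (-7, -1, -11), (-11, -3, -12)]⟩,
   ⟨[12, 18, 26, 67, 79, 89, 129, 147, 157, 159, 278, 279], [46, 49, 45, 3, 5, 4, 69], [3, 4, 5, 0,
    1, 2, 9, 8, 7, 6], [(4, 3, 9), (-10, 3, -6), (8, 2, 12), (-4, -3, 9), (10, -3, -6), (-8, -2,
    12), (4, -11, 7), (-11, 15, 9), (11, -15, 9), (-4, 11, 7)]⟩,
   ⟨[15, 18, 27, 29, 56, 67, 89, 129, 148, 149, 248, 278], [4, 2, 3, 69, 79, 45, 47], [3, 5, 6, 0,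
    7, 1, 2, 4, 9, 8], [(-11, 11, 15), (-2, 15, -8), (-1, 7, 2), (11, -11, 15), (-5, 14, -15), (2,
    -15, -8), (1, -7, 2), (5, -14, -15), (-15, 9, 11), (15, -9, 11)]⟩,
   ⟨[12, 14, 25, 38, 39, 48, 67, 79, 129, 146, 167, 279], [49, 45, 3, 4, 18, 47, 69, 89], [5, 8, 6,
    9, 7, 0, 2, 4, 1, 3], [(-12, 0, -15), (-4, 2, -9), (15, 14, -13), (10, -15, 7), (14, -15, 11),
    (12, 0, -15), (-15, -14, -13), (-14, 15, 11), (4, -2, -9), (-10, 15, 7)]⟩,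
   ⟨[12, 18, 25, 46, 47, 56, 78, 126, 148, 149, 248, 268], [4, 3, 67, 58, 69, 78, 9, 27, 29, 89],
    [3, 9, 5, 0, 6, 2, 4, 8, 7, 1], [(9, -11, 12), (0, -1, -3), (9, 6, 9), (-9, 11, 12), (12, -5,
    11), (-9, -6, 9), (-12, 5, 11), (4, 0, -12), (-4, 0, -12), (0, 1, -3)]⟩,
   ⟨[12, 16, 124, 134, 138, 167, 179, 189, 238, 249, 278, 279], [4, 3, 24, 19, 8, 9, 7, 48], [0, 5,
    6, 7, 8, 1, 2, 3, 4, 9], [(0, 0, 15), (22, 28, 0), (13, -30, 18), (-26, 6, 19), (12, -12, 13),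
    (-22, -28, 0), (-13, 30, 18), (26, -6, 19), (-12, 12, 13), (0, 0, -16)]⟩,
   ⟨[12, 19, 23, 35, 58, 67, 68, 124, 148, 238, 256, 258], [4, 24, 19, 8, 56, 47, 29, 78, 57], [9,
    7, 4, 5, 2, 3, 8, 1, 6, 0], [(-33, 58, 10), (-2, 6, -21), (27, 15, -45), (-42, -26, -53), (-27,
    -15, -45), (42, 26, -53), (-47, -3, 19), (2, -6, -21), (47, 3, 19), (33, -58, 10)]⟩,
   ⟨[12, 18, 23, 35, 46, 47, 56, 79, 127, 238, 267, 368], [4, 24, 29, 67, 58, 78, 68, 34], [9, 1, 4,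
    5, 2, 3, 6, 8, 7, 0], [(-4, -15, 0), (0, 0, -6), (-15, -8, 8), (-3, 2, 15), (15, 8, 8), (3, -2,
    15), (0, 0, 9), (-9, 5, 6), (9, -5, 6), (4, 15, 0)]⟩,
   ⟨[13, 18, 27, 29, 56, 67, 89, 129, 146, 148, 169, 248], [4, 2, 69, 78, 79, 45, 47, 49], [3, 5, 6,
    0, 7, 1, 2, 4, 9, 8], [(-2, 14, -6), (-6, -9, 2), (-15, -4, -15), (2, -14, -6), (8, -2, -13),
    (6, 9, 2), (15, 4, -15), (-8, 2, -13), (7, 11, 8), (-7, -11, 8)]⟩,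
   ⟨[12, 19, 23, 35, 58, 67, 68, 127, 136, 138, 146, 238], [4, 24, 19, 8, 48, 34, 56, 47, 29, 24],
    [9, 7, 4, 5, 2, 3, 8, 1, 6, 0], [(9, 14, 14), (5, 6, 8), (2, -3, -8), (-15, 7, -13), (-2, 3,
    -8), (15, -7, -13), (6, 14, 15), (-5, -6, 8), (-6, -14, 15), (-9, -14, 14)]⟩,
   ⟨[16, 17, 27, 29, 35, 38, 56, 123, 146, 179, 346, 359], [4, 2, 1, 78, 79, 45, 49, 47, 67], [8, 2,
    1, 9, 7, 6, 5, 4, 0, 3], [(-7, 15, -15), (14, -10, 15), (-14, 10, 15), (15, -2, 12), (2, -8,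
    10), (2, 0, -2), (-2, 0, -2), (-2, 8, 10), (7, -15, -15), (-15, 2, 12)]⟩,
   ⟨[17, 18, 23, 27, 35, 56, 69, 123, 128, 136, 146, 368], [4, 29, 69, 7, 12, 48, 24, 34], [9, 7, 4,
    5, 2, 3, 8, 1, 6, 0], [(-19, -5, 23), (8, -1, 8), (-29, 3, -2), (30, 6, 21), (29, -3, -2), (-30,
    -6, 21), (30, 25, 28), (-8, 1, 8), (-30, -25, 28), (19, 5, 23)]⟩,
   ⟨[12, 18, 24, 129, 134, 138, 149, 235, 238, 246, 256, 346], [4, 3, 5, 24, 48, 67, 6], [0, 7, 9,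
    5, 8, 3, 6, 1, 4, 2], [(0, 0, -12), (15, 1, 1), (15, -11, 7), (6, 9, -4), (-12, -15, -6), (-6,
    -9, -4), (0, 0, -7), (-15, -1, 1), (12, 15, -6), (-15, 11, 7)]⟩,
   ⟨[12, 19, 28, 35, 38, 46, 47, 56, 124, 134, 138, 346], [4, 24, 19, 8, 23, 48, 67], [9, 7, 2, 5,
    8, 3, 6, 1, 4, 0], [(1, -5, 2), (10, 8, 4), (0, 0, -15), (-10, -12, 15), (4, 8, 4), (10, 12,
    15), (0, 0, 5), (-10, -8, 4), (-4, -8, 4), (-1, 5, 2)]⟩,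
   ⟨[12, 18, 24, 47, 79, 89, 127, 148, 149, 179, 278, 457], [4, 3, 5, 24, 29, 67, 6], [6, 3, 9, 1,
    8, 7, 0, 5, 4, 2], [(-6, 2, 3), (-12, 2, 1), (10, -8, 4), (12, -2, 1), (-7, 12, 12), (-12, 6,
    -10), (6, -2, 3), (12, -6, -10), (7, -12, 12), (-10, 8, 4)]⟩,
   ⟨[12, 18, 24, 45, 56, 67, 79, 147, 148, 157, 347, 367], [46, 49, 45, 3, 35, 69, 78], [9, 2, 1, 6,
    5, 4, 3, 8, 7, 0], [(-1, 30, 15), (-23, 16, 29), (23, -16, 29), (-10, -17, -12), (27, 30, -25),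
    (-27, -30, -25), (10, 17, -12), (1, 9, -10), (-1, -9, -10), (1, -30, 15)]⟩,
   ⟨[12, 18, 23, 35, 46, 49, 56, 124, 134, 138, 238, 346], [4, 24, 19, 48, 49, 67, 7], [9, 7, 2, 5,
    8, 3, 6, 1, 4, 0], [(-8, 11, 10), (2, -2, 4), (0, 0, 2), (1, 0, -8), (8, -2, 15), (-1, 0, -8),
    (0, 0, -15), (-2, 2, 4), (-8, 2, 15), (8, -11, 10)]⟩,
   ⟨[13, 14, 35, 48, 56, 67, 79, 123, 238, 257, 258, 367], [4, 2, 18, 24, 46, 49, 78], [9, 1, 4, 5,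
    2, 3, 6, 8, 7, 0], [(-8, -15, 15), (0, 0, 9), (10, -7, 11), (-6, 3, 7), (-10, 7, 11), (6, -3,
    7), (0, 0, -8), (-15, 0, 13), (15, 0, 13), (8, 15, 15)]⟩,
   ⟨[12, 17, 28, 34, 35, 48, 67, 129, 148, 178, 268, 367], [46, 69, 78, 9, 8, 24, 58, 39], [5, 9, 4,
    6, 2, 0, 3, 8, 7, 1], [(-13, -8, -15), (-6, 12, 3), (-12, 0, 15), (3, 0, -14), (12, 0, 15), (13,
    8, -15), (-3, 0, -14), (2, -1, -1), (-2, 1, -1), (6, -12, 3)]⟩,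
   ⟨[12, 18, 24, 34, 35, 67, 78, 123, 136, 148, 179, 289], [29, 78, 9, 27, 58, 25, 68, 69, 26, 39],
    [5, 4, 7, 6, 1, 0, 3, 2, 9, 8], [(-17, -20, -30), (28, -19, 22), (-1, -2, 0), (3, 5, -17), (-28,
    19, 22), (17, 20, -30), (-3, -5, -17), (1, 2, 0), (30, -7, 1), (-30, 7, 1)]⟩,
   ⟨[12, 18, 23, 35, 56, 67, 78, 127, 238, 257, 258, 367], [4, 24, 29, 46, 78, 9], [9, 1, 4, 5, 2,
    3, 6, 8, 7, 0], [(11, 6, 7), (0, 0, 5), (-4, -12, 5), (-5, 10, 9), (4, 12, 5), (5, -10, 9), (0,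
    0, -12), (3, 12, -5), (-3, -12, -5), (-11, -6, 7)]⟩,
   ⟨[12, 18, 24, 46, 67, 79, 89, 129, 147, 157, 278, 279], [46, 49, 45, 3, 5, 59, 69], [3, 4, 5, 0,
    1, 2, 9, 8, 7, 6], [(13, 9, 8), (15, 9, 1), (-13, -10, 12), (-13, -9, 8), (-15, -9, 1), (13, 10,
    12), (-1, 2, 11), (-6, 8, 15), (6, -8, 15), (1, -2, 11)]⟩,
   ⟨[12, 14, 23, 35, 49, 58, 67, 68, 146, 156, 346, 348], [4, 18, 24, 49, 8, 56, 47, 45], [9, 2, 1,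
    5, 7, 3, 8, 4, 6, 0], [(-10, 12, 5), (-1, 2, 2), (1, -2, 2), (0, 3, -4), (-2, 10, -2), (0, -3,
    -4), (-4, -8, -10), (2, -10, -2), (4, 8, -10), (10, -12, 5)]⟩,
   ⟨[13, 18, 27, 29, 56, 67, 89, 129, 148, 149, 248, 278], [4, 2, 69, 79, 45, 47], [3, 5, 6, 0, 7,
    1, 2, 4, 9, 8], [(9, 10, -5), (-15, -3, 2), (-13, 2, -10), (-9, -10, -5), (2, -4, -7), (15, 3,
    2), (13, -2, -10), (-2, 4, -7), (15, 6, 11), (-15, -6, 11)]⟩,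
   ⟨[12, 18, 24, 34, 35, 56, 69, 146, 148, 167, 346, 368], [69, 7, 79, 45, 49, 47], [9, 2, 1, 5, 7,
    3, 8, 4, 6, 0], [(30, -14, 26), (24, -14, 22), (-24, 14, 22), (-16, 3, 3), (-1, -9, 11), (16,
    -3, 3), (27, 29, -28), (1, 9, 11), (-27, -29, -28), (-30, 14, 26)]⟩,
   ⟨[14, 17, 27, 29, 35, 38, 46, 56, 123, 179, 346, 359], [4, 2, 1, 67, 79, 45, 49, 47], [8, 2, 1,
    9, 7, 6, 5, 4, 0, 3], [(-18, 12, 29), (20, 23, -14), (-20, -23, -14), (-1, 30, 2), (20, 4, -4),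
    (-6, 13, 19), (6, -13, 19), (-20, -4, -4), (18, -12, 29), (1, -30, 2)]⟩,
   ⟨[12, 18, 23, 46, 47, 56, 78, 126, 148, 149, 248, 268], [4, 67, 58, 69, 78, 9, 27, 29, 89], [3,
    9, 5, 0, 6, 2, 4, 8, 7, 1], [(10, -12, 4), (2, -12, -12), (-2, 1, -1), (-10, 12, 4), (-4, -13,
    8), (2, -1, -1), (4, 13, 8), (3, -15, -15), (-3, 15, -15), (-2, 12, -12)]⟩,
   ⟨[12, 18, 23, 35, 56, 69, 146, 148, 157, 167, 346, 368], [4, 49, 45, 47, 69, 7, 79], [9, 2, 1, 5,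
    7, 3, 8, 4, 6, 0], [(24, 30, -24), (-8, -14, -2), (8, 14, -2), (19, -23, 15), (-24, 23, 10),
    (-19, 23, 15), (-9, 0, 4), (24, -23, 10), (9, 0, 4), (-24, -30, -24)]⟩,
   ⟨[14, 17, 27, 29, 35, 38, 46, 56, 123, 157, 159, 359], [4, 2, 1, 34, 49, 45, 67, 47, 79], [8, 2,
    1, 9, 7, 6, 5, 4, 0, 3], [(24, 7, 30), (-15, -10, 5), (15, 10, 5), (-20, -26, 23), (-20, -16,
    26), (8, 0, 29), (-8, 0, 29), (20, 16, 26), (-24, -7, 30), (20, 26, 23)]⟩,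
   ⟨[12, 14, 23, 39, 47, 58, 67, 68, 146, 157, 167, 346], [4, 18, 49, 8, 45, 47, 9, 35, 56], [9, 2,
    1, 5, 7, 3, 8, 4, 6, 0], [(-1, 9, -4), (-1, 0, 8), (1, 0, 8), (-6, 2, 2), (15, -3, 14), (6, -2,
    2), (-7, -8, -6), (-15, 3, 14), (7, 8, -6), (1, -9, -4)]⟩,
   ⟨[12, 18, 24, 34, 35, 69, 89, 123, 136, 148, 179, 238], [29, 69, 7, 78, 27, 58, 25, 39, 68, 26],
    [5, 4, 7, 6, 1, 0, 3, 2, 9, 8], [(-3, 5, 0), (-9, -10, 15), (-20, 26, -27), (6, -5, -12), (9,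
    10, 15), (3, -5, 0), (-6, 5, -12), (20, -26, -27), (13, -1, 2), (-13, 1, 2)]⟩,
   ⟨[12, 16, 28, 34, 35, 48, 124, 148, 168, 236, 238, 378], [69, 78, 9, 58, 68, 7, 8, 24, 19, 89],
    [5, 9, 4, 6, 2, 0, 3, 8, 7, 1], [(0, -2, 7), (3, -5, -4), (-4, 8, -1), (-5, -5, 9), (4, -8, -1),
    (0, 2, 7), (5, 5, 9), (7, -10, -9), (-7, 10, -9), (-3, 5, -4)]⟩,
   ⟨[15, 18, 25, 26, 67, 79, 123, 129, 135, 146, 234, 257], [4, 2, 3, 69, 78, 58, 56, 47, 45, 49],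
    [8, 9, 6, 5, 7, 3, 2, 4, 0, 1], [(16, 30, 14), (0, 2, 15), (20, -30, 30), (8, -13, 27), (24, 2,
    -10), (-8, 13, 27), (-20, 30, 30), (-24, -2, -10), (-16, -30, 14), (0, -2, 15)]⟩,
   ⟨[13, 18, 25, 26, 35, 67, 79, 123, 129, 146, 234, 257], [4, 2, 69, 78, 58, 39, 56, 47, 45, 49],
    [8, 9, 6, 5, 7, 3, 2, 4, 0, 1], [(-29, 11, -29), (-1, 1, -23), (7, 28, -30), (9, -30, 1), (25,
    -8, -27), (-9, 30, 1), (-7, -28, -30), (-25, 8, -27), (29, -11, -29), (1, -1, -23)]⟩,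
   ⟨[12, 18, 24, 45, 56, 67, 78, 147, 148, 157, 347, 367], [46, 49, 45, 3, 35, 69, 78, 9], [9, 2, 1,
    6, 5, 4, 3, 8, 7, 0], [(-60, -45, -31), (39, -57, -1), (-39, 57, -1), (5, -24, 24), (-45, 23,
    60), (45, -23, 60), (-5, 24, 24), (-3, 14, 14), (3, -14, 14), (60, 45, -31)]⟩,
   ⟨[12, 18, 24, 45, 56, 67, 79, 147, 148, 157, 346, 358], [49, 45, 3, 35, 69, 68, 78], [9, 2, 1, 6,
    5, 4, 3, 8, 7, 0], [(-53, -60, 19), (60, 15, 47), (-60, -15, 47), (-8, -4, 2), (-26, -12, -60),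
    (26, 12, -60), (8, 4, 2), (10, 13, 15), (-10, -13, 15), (53, 60, 19)]⟩,
   ⟨[12, 18, 25, 46, 47, 56, 79, 127, 234, 238, 267, 368], [4, 3, 24, 29, 67, 58, 78, 68, 34, 59,
    35], [9, 1, 4, 5, 2, 3, 6, 8, 7, 0], [(4, 2, 1), (0, 0, -12), (9, 1, 11), (-8, -3, 10), (-9, -1,
    11), (8, 3, 10), (0, 0, 4), (-4, -7, 4), (4, 7, 4), (-4, -2, 1)]⟩,
   ⟨[12, 18, 25, 46, 47, 56, 79, 127, 234, 258, 267, 358], [4, 3, 24, 29, 67, 58, 23, 78, 68, 69,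
    36], [9, 1, 4, 6, 2, 5, 3, 8, 7, 0], [(-2, 11, 5), (0, 0, -3), (12, 12, 10), (-9, 5, 12), (-12,
    -12, 10), (0, 0, 7), (9, -5, 12), (8, -5, 3), (-8, 5, 3), (2, -11, 5)]⟩,
   ⟨[12, 18, 23, 35, 46, 48, 56, 124, 134, 138, 238, 346], [4, 24, 19, 48, 49, 67, 7, 9], [9, 7, 2,
    5, 8, 3, 6, 1, 4, 0], [(-9, -15, 10), (7, 11, 9), (0, 0, 7), (4, -1, 4), (13, 0, 12), (-4, 1,
    4), (0, 0, -15), (-7, -11, 9), (-13, 0, 12), (9, 15, 10)]⟩,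
   ⟨[12, 18, 23, 35, 56, 67, 79, 125, 138, 238, 258, 367], [4, 24, 29, 46, 48, 78, 27], [9, 1, 4, 5,
    2, 3, 6, 8, 7, 0], [(34, -60, 54), (0, 0, -16), (-15, -7, -31), (57, 37, -52), (15, 7, -31),
    (-57, -37, -52), (0, 0, 56), (4, 3, 4), (-4, -3, 4), (-34, 60, 54)]⟩,
   ⟨[12, 14, 23, 35, 48, 56, 69, 146, 158, 167, 178, 368], [4, 18, 34, 49, 45, 47, 57, 69, 7], [9,
    2, 1, 5, 7, 3, 8, 4, 6, 0], [(-12, 10, 15), (1, 1, 6), (-1, -1, 6), (-3, -4, -15), (13, -9, 12),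
    (3, 4, -15), (4, 6, 3), (-13, 9, 12), (-4, -6, 3), (12, -10, 15)]⟩,
   ⟨[12, 17, 28, 34, 35, 48, 67, 124, 148, 178, 268, 367], [46, 69, 78, 9, 8, 24, 19, 58, 39], [5,
    9, 4, 6, 2, 0, 3, 8, 7, 1], [(4, 8, 4), (-12, 1, 5), (-5, 12, 12), (5, 12, -8), (5, -12, 12),
    (-4, -8, 4), (-5, -12, -8), (3, -4, 6), (-3, 4, 6), (12, -1, 5)]⟩,
   ⟨[12, 17, 28, 34, 35, 48, 67, 124, 148, 178, 236, 238], [69, 78, 9, 8, 24, 19, 58, 39, 68], [5,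
    9, 4, 6, 2, 0, 3, 8, 7, 1], [(-2, 12, 0), (15, -8, 0), (15, 12, 15), (0, 3, -4), (-15, -12, 15),
    (2, -12, 0), (0, -3, -4), (-3, -2, 2), (3, 2, 2), (-15, 8, 0)]⟩,
   ⟨[15, 17, 36, 37, 123, 129, 135, 148, 178, 238, 257, 258], [4, 2, 3, 24, 46, 67, 78, 9, 8], [6,
    9, 4, 5, 2, 3, 0, 8, 7, 1], [(-5, -8, 25), (-25, 30, 30), (26, 30, 27), (14, 22, -6), (-26, -30,
    27), (-14, -22, -6), (5, 8, 25), (4, -1, 28), (-4, 1, 28), (25, -30, 30)]⟩,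
   ⟨[16, 27, 29, 67, 89, 234, 235, 248, 256, 278, 346, 368], [4, 3, 5, 2, 69, 79, 45, 47], [1, 0, 9,
    5, 7, 3, 8, 4, 6, 2], [(-3, -4, -12), (3, 4, -12), (9, 15, -13), (-13, 12, 13), (3, 2, 4), (13,
    -12, 13), (-1, -1, -2), (-3, -2, 4), (1, 1, -2), (-9, -15, -13)]⟩,
   ⟨[12, 18, 25, 56, 69, 135, 146, 148, 157, 167, 346, 368], [4, 3, 49, 45, 47, 59, 69, 7, 79], [9,
    2, 1, 5, 7, 3, 8, 4, 6, 0], [(-5, -4, -15), (3, 3, -1), (-3, -3, -1), (-1, 13, 10), (3, -15, 0),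
    (1, -13, 10), (2, -9, 0), (-3, 15, 0), (-2, 9, 0), (5, 4, -15)]⟩,
   ⟨[12, 18, 24, 45, 56, 67, 79, 147, 148, 157, 347, 378], [46, 49, 45, 3, 35, 69, 78, 36], [9, 2,
    1, 6, 5, 4, 3, 8, 7, 0], [(-12, -20, 14), (0, -24, 23), (0, 24, 23), (1, -3, -1), (-15, -3, -5),
    (15, 3, -5), (-1, 3, -1), (-2, -3, 3), (2, 3, 3), (12, 20, 14)]⟩,
   ⟨[13, 14, 35, 48, 56, 69, 123, 128, 157, 158, 167, 368], [4, 2, 18, 29, 27, 69, 7, 78, 79], [9,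
    4, 7, 5, 1, 3, 8, 2, 6, 0], [(-14, 4, 0), (-27, 8, 4), (4, 29, -25), (28, -29, -5), (27, -8, 4),
    (-28, 29, -5), (19, 0, 30), (-4, -29, -25), (-19, 0, 30), (14, -4, 0)]⟩]

theorem movesTo_triangles : ∀ r ∈ realizedTriangulations,
    MovesTo (r.flips.map digitEdge) baseFacets (triangles r.triangleList) := by
  decide +kernel

theorem nodup_map_colourInvariant : (realizedTriangulations.map fun r =>
    colourInvariant (triangles r.triangleList)).Nodup := by
  decide +kernel

theorem eq_three_of_mem_map_card : ∀ r ∈ realizedTriangulations,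
    ∀ n ∈ r.triangleList.map (fun t => (triangle t).card), n = 3 := by
  decide +kernel

theorem mem_flatMap_triangleList : ∀ r ∈ realizedTriangulations,
    ∀ v, v ∈ r.triangleList.flatMap fun t => [t.1, t.2.1, t.2.2] := by
  decide +kernel

theorem vertexMap_vertexMap : ∀ r ∈ realizedTriangulations,
    ∀ v, r.vertexMap (r.vertexMap v) = v := by
  decide +kernel

theorem position_vertexMap : ∀ r ∈ realizedTriangulations, ∀ v, r.position (r.vertexMap v) =
    (-(r.position v).1, -(r.position v).2.1, (r.position v).2.2) := by
  decide +kernel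

theorem zero_notMem_map_crossProd : ∀ r ∈ realizedTriangulations, ∀ v ≤ r.vertexMap v,
    0 ∉ (linkEdges r.triangleList v).map fun e =>
      crossProd (r.position e.1 - r.position v) (r.position e.2 - r.position v) := by
  decide +kernel

theorem pairwise_conesSeparated : ∀ r ∈ realizedTriangulations, ∀ v ≤ r.vertexMap v,
    (linkEdges r.triangleList v).Pairwise
      (ConesSeparated fun w => r.position w - r.position v) := by
  decide +kernel

theorem card_of_mem_triangles : ∀ r ∈ realizedTriangulations,
    ∀ t ∈ triangles r.triangleList, t.card = 3 := by
  intro r hr s hs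
  obtain ⟨t, ht, rfl⟩ := mem_triangles.1 hs
  exact eq_three_of_mem_map_card r hr _ (List.mem_map_of_mem ht)

theorem exists_mem_triangles : ∀ r ∈ realizedTriangulations,
    ∀ v, ∃ t ∈ triangles r.triangleList, v ∈ t := by
  intro r hr v
  obtain ⟨t, ht, hv⟩ := List.mem_flatMap.1 (mem_flatMap_triangleList r hr v)
  exact ⟨triangle t, mem_triangles.2 ⟨t, ht, rfl⟩, by simpa [triangle] using hv⟩

theorem map_vertexMap_mem_triangleList {r : RealizedTriangulation}
    (hr : Function.Involutive r.vertexMap) : ∀ t ∈ r.triangleList,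
    t.map r.vertexMap (Prod.map r.vertexMap r.vertexMap) ∈ r.triangleList := by
  intro t ht
  rcases List.mem_append.1 ht with ht | ht
  · exact List.mem_append_right _ (List.mem_map_of_mem ht)
  · obtain ⟨s, hs, rfl⟩ := List.mem_map.1 ht
    rw [hr.prodMap (hr.prodMap hr) s]
    exact List.mem_append_left _ hs

theorem isTriangulationOf_triangles {r : RealizedTriangulation} (hr : r ∈ realizedTriangulations) :
    IsTriangulationOf (facetComplex (triangles r.triangleList) (exists_mem_triangles r hr))
      (NonorientableSurface 4) := by
  obtain ⟨f⟩ := (movesTo_triangles r hr).nonempty_homeomorph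
  obtain ⟨g⟩ := nonempty_homeomorph_baseFacets
  exact isTriangulationOf_facetComplex _ (card_of_mem_triangles r hr) ⟨f.symm.trans g⟩

theorem exists_symmetric_realization {r : RealizedTriangulation} (hr : r ∈ realizedTriangulations) :
    IsPolyhedralImmersion (facetComplex (triangles r.triangleList) (exists_mem_triangles r hr))
        (intPoint ∘ r.position) ∧
      IsGeometricSymmetry (facetComplex (triangles r.triangleList) (exists_mem_triangles r hr))
        (intPoint ∘ r.position) axisRotation := by
  have hinv : Function.Involutive r.vertexMap := vertexMap_vertexMap r hr
  refine isPolyhedralImmersion_and_isGeometricSymmetry (S := {v | v ≤ r.vertexMap v})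
    (card_of_mem_triangles r hr) hinv (map_vertexMap_mem_triangleList hinv)
    (position_vertexMap r hr) (fun v => ?_) (fun v hv e he h => ?_) (pairwise_conesSeparated r hr)
  · rw [Set.mem_ofPred_eq, Set.mem_ofPred_eq, hinv v]
    exact le_total _ _
  · exact zero_notMem_map_crossProd r hr v hv (h ▸ List.mem_map_of_mem he)

theorem not_isomorphic_triangles {i j : ℕ} (hi : i < realizedTriangulations.length)
    (hj : j < realizedTriangulations.length) (hij : i ≠ j) :
    ¬ Isomorphic
      (facetComplex _ (exists_mem_triangles _ (List.getElem_mem hi)))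
      (facetComplex _ (exists_mem_triangles _ (List.getElem_mem hj))) := by
  intro h
  have hinv := colourInvariant_eq_of_isomorphic
    (card_of_mem_triangles _ (List.getElem_mem hi))
    (card_of_mem_triangles _ (List.getElem_mem hj)) h
  refine hij ((nodup_map_colourInvariant.getElem_inj_iff (hi := by simpa) (hj := by simpa)).1 ?_)
  simpa using hinv

end Catalogue

theorem theorem5 :
    ∃ Δ : Fin 112 → AbstractSimplicialComplex (Fin 10),
      (∀ i, IsTriangulationOf (Δ i) (NonorientableSurface 4)) ∧
      (∀ i j, i ≠ j → ¬ Isomorphic (Δ i) (Δ j)) ∧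
      ∀ i, ∃ ψ : Fin 10 → Space3,
        (∀ v c, ∃ n : ℤ, ψ v c = n) ∧
        IsPolyhedralImmersion (Δ i) ψ ∧
        ∃ R : Space3 ≃ᵃⁱ[ℝ] Space3, IsTwofoldRotation R ∧ IsGeometricSymmetry (Δ i) ψ R := by
  have hlength : realizedTriangulations.length = 112 := rfl
  have hmem (i : Fin 112) := List.getElem_mem (i.2.trans_eq hlength.symm)
  refine ⟨fun i => facetComplex _ (exists_mem_triangles _ (hmem i)),
    fun i => isTriangulationOf_triangles (hmem i),
    fun i j hij => not_isomorphic_triangles _ _ (Fin.val_ne_of_ne hij), fun i => ?_⟩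
  obtain ⟨himmersion, hsymmetry⟩ := exists_symmetric_realization (hmem i)
  exact ⟨_, fun v => exists_intPoint_eq _, himmersion, axisRotation,
    isTwofoldRotation_axisRotation, hsymmetry⟩
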